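/- For every integer $k\ge 0$ define two graphs $Q_k$ and $Q_k'$ as follows. Take $k+2$ nested 4-cycles $D_i=a_ib_ic_id_i$ $(i=0,1,\dots,k+1)$, and for $0\le i\le k$ join $D_i$ to $D_{i+1}$ by an antiprism (an annulus triangulated so that every vertex of $D_i$ is joined to two consecutive vertices of $D_{i+1}$): if $i$ is even, join $a_i$ to $a_{i+1},b_{i+1}$, $b_i$ to $b_{i+1},c_{i+1}$, $c_i$ to $c_{i+1},d_{i+1}$, and $d_i$ to $d_{i+1},a_{i+1}$; if $i$ is odd, join $a_i$ to $a_{i+1},d_{i+1}$, $b_i$ to $b_{i+1},a_{i+1}$, $c_i$ to $c_{i+1},b_{i+1}$, and $d_i$ to $d_{i+1},c_{i+1}$. The graph $Q_k$ is obtained by adding the edges $a_0c_0$ and $a_{k+1}c_{k+1}$, and $Q_k'$ by adding instead the edges $a_0c_0$ and $b_{k+1}d_{k+1}$. Here 4-colorings are proper colorings with (at most) four colors, considered up to renaming of the colors, so that a 4-coloring is determined by its color classes $A,B,C,D$. The 4-coloring complex $B(G)$ of a graph $G$ is the graph whose vertices are the color classes of all 4-colorings of $G$, two distinct color classes being adjacent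 if they appear together in some 4-coloring; a component of $B(G)$ contains a 4-coloring if it contains its color classes. Let $p(X,Y)$ be the number of connected components of $G[X\cup Y]$. A 4-coloring $f$ is even or odd according to the parity of $$J_A(f)=p(A,B)+p(A,C)+p(A,D)-p(B,C)-p(B,D)-p(C,D),$$ which does not depend on the choice of the color class $A$. For an oriented triangulation of the plane, the homology degree of $f$ is the degree of $f$ as a simplicial map to the boundary of the tetrahedron whose vertices are the four colors: for each oriented face of the tetrahedron, the number of facial triangles mapped onto it with positive orientation minus the number mapped onto it with negative orientation. **Theorem.** For every integer $k\ge 0$, let $G$ be $Q_k$ or $Q_k'$. Then $G$ is a 4-connected triangulation of the plane, and $B(G)$ has exactly $2^k+1$ connected components. One of them contains exactly $2^{k+1}$ 4-colorings, all of them odd. Each of the other $2^k$ components contains exactly one 4-coloring, which is even and has odd homology degree. -/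

import Mathlib

namespace TutteComplex

variable {V : Type*}

/-! ### Connectivity -/

/-- A graph is `m`-connected if it has more than `m` vertices and remains connected after
deleting any set of fewer than `m` vertices. -/
def IsVertexConnected (m : ℕ) (G : SimpleGraph V) : Prop :=
  m < Nat.card V ∧ ∀ S : Finset V, S.card < m → (G.induce ((S : Set V)ᶜ)).Connected

/-! ### Triangulations of the plane, as rotation systems -/

/-- A rotation system on `G`: a permutation of the darts (oriented edges) that permutes
cyclically the darts leaving each vertex. This is the combinatorial description of a cellular
embedding of a connected graph in an oriented closed surface. -/
structure RotationSystem (G : SimpleGraph V) where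
  /-- the next dart around the initial vertex -/
  rot : Equiv.Perm G.Dart
  fst_rot : ∀ d, (rot d).fst = d.fst
  sameCycle_rot : ∀ d e : G.Dart, d.fst = e.fst → rot.SameCycle d e

/-- The face permutation: traverse the dart `d`, then turn to the next dart at its end.
Its cycles are the oriented boundary walks of the faces. -/
def RotationSystem.face {G : SimpleGraph V} (R : RotationSystem G) : Equiv.Perm G.Dart :=
  (Function.Involutive.toPerm _ SimpleGraph.Dart.symm_involutive).trans R.rot

/-- The faces of the embedding: the cycles of the face permutation. -/
def RotationSystem.Faces {G : SimpleGraph V} (R : RotationSystem G) : Type _ :=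
  Quotient (Equiv.Perm.SameCycle.setoid R.face)

/-- A triangulation of the plane (equivalently of the sphere), with an orientation, whose graph
is the finite simple graph `G`: `G` is connected, each face is bounded by a triangle
(a face permutation cycle has length 3; it cannot be fixed, as `G` has no loops),
and the surface has genus 0, by Euler's formula. -/
structure PlaneTriangulation [Finite V] (G : SimpleGraph V) extends RotationSystem G where
  connected : G.Connected
  face_triangle : ∀ d, toRotationSystem.face (toRotationSystem.face (toRotationSystem.face d)) = d
  euler : (Nat.card V : ℤ) - Nat.card G.edgeSet + Nat.card toRotationSystem.Faces = 2

/-! ### 4-colorings, their parity and their homology degree -/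

/-- The set of the four color classes of a proper coloring with colors `0, 1, 2, 3`. -/
def classes {G : SimpleGraph V} (C : G.Coloring (Fin 4)) : Set (Set V) :=
  Set.range C.colorClass

/-- The 4-colorings of `G`, where colorings that differ only in the names of the colors are
the same: a 4-coloring is given by its set of color classes. -/
def IsFourColoring (G : SimpleGraph V) (P : Set (Set V)) : Prop :=
  ∃ C : G.Coloring (Fin 4), classes C = P

/-- `p(A, B)` for the classes `A`, `B` of the colors `a`, `b`: the number of Kempe chains,
i.e. of connected components of the subgraph induced on `A ∪ B`. -/
noncomputable def kempeChains {G : SimpleGraph V} (C : G.Coloring (Fin 4)) (a b : Fin 4) : ℕ :=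
  Nat.card (G.induce (C.colorClass a ∪ C.colorClass b)).ConnectedComponent

/-- `J_A(f)`, where `A` is the class of the color `a`: the sum of `p(A, X)` over the three other
classes `X`, minus the sum of `p(X, Y)` over the three pairs of classes other than `A`. -/
noncomputable def J {G : SimpleGraph V} (C : G.Coloring (Fin 4)) (a : Fin 4) : ℤ :=
  (∑ b ∈ Finset.univ.filter (fun b : Fin 4 => b ≠ a), (kempeChains C a b : ℤ)) -
    ∑ x ∈ Finset.univ.filter (fun x : Fin 4 × Fin 4 => x.1 < x.2 ∧ x.1 ≠ a ∧ x.2 ≠ a),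
      (kempeChains C x.1 x.2 : ℤ)

/-- The 4-coloring with set of classes `P` is even: `J_A` is even (for every class `A`). -/
def IsEvenColoring (G : SimpleGraph V) (P : Set (Set V)) : Prop :=
  IsFourColoring G P ∧ ∀ C : G.Coloring (Fin 4), classes C = P → ∀ a, Even (J C a)

/-- The 4-coloring with set of classes `P` is odd: `J_A` is odd (for every class `A`). -/
def IsOddColoring (G : SimpleGraph V) (P : Set (Set V)) : Prop :=
  IsFourColoring G P ∧ ∀ C : G.Coloring (Fin 4), classes C = P → ∀ a, Odd (J C a)

/-- The number of faces whose vertices, in the cyclic order of the oriented boundary, have the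
colors `i, j, l`. (Each such face is counted once, by its dart from color `i` to color `j`.) -/
noncomputable def facesColored [Finite V] {G : SimpleGraph V} (T : PlaneTriangulation G)
    (C : G.Coloring (Fin 4)) (i j l : Fin 4) : ℕ :=
  Nat.card {d : G.Dart // C d.fst = i ∧ C (T.face d).fst = j ∧ C (T.face (T.face d)).fst = l}

/-- The homology degree of the coloring `C`, seen as a simplicial map from the oriented
triangulation `T` to the boundary of the tetrahedron with vertices `0, 1, 2, 3`, is `n`:
for each face of the tetrahedron, listed as `(i, j, l)` in its boundary orientation (that is,
`(m, i, j, l)` is an even permutation of `(0, 1, 2, 3)`), the number of faces of `T` mapped onto it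
with positive orientation, minus the number of those mapped with negative orientation, is `n`. -/
def HasHomologyDegree [Finite V] {G : SimpleGraph V} (T : PlaneTriangulation G)
    (C : G.Coloring (Fin 4)) (n : ℤ) : Prop :=
  ∀ σ : Equiv.Perm (Fin 4), Equiv.Perm.sign σ = 1 →
    (facesColored T C (σ 1) (σ 2) (σ 3) : ℤ) - facesColored T C (σ 2) (σ 1) (σ 3) = n

/-- The 4-coloring with set of classes `P` has odd homology degree. (Renaming the colors or
reversing the orientation changes the degree at most by a sign.) -/
def HasOddHomologyDegree [Finite V] (G : SimpleGraph V) (P : Set (Set V)) : Prop :=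
  ∀ (T : PlaneTriangulation G) (C : G.Coloring (Fin 4)), classes C = P →
    ∃ n : ℤ, Odd n ∧ HasHomologyDegree T C n

/-! ### The coloring complex -/

/-- The vertices of the coloring complex: the color classes of all 4-colorings. -/
def ColorClass (G : SimpleGraph V) : Type _ :=
  {A : Set V // ∃ P, IsFourColoring G P ∧ A ∈ P}

/-- The 4-coloring complex `B(G)`: two color classes are adjacent if they are distinct and
appear together in a 4-coloring. -/
def coloringComplex (G : SimpleGraph V) : SimpleGraph (ColorClass G) where
  Adj A B := A ≠ B ∧ ∃ P, IsFourColoring G P ∧ A.1 ∈ P ∧ B.1 ∈ P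
  symm := ⟨fun _ _ h => ⟨h.1.symm, h.2.imp fun _ hP => ⟨hP.1, hP.2.2, hP.2.1⟩⟩⟩
  loopless := ⟨fun _ h => h.1 rfl⟩

/-- The 4-colorings that a component `K` of the coloring complex contains: those whose color
classes are vertices of `K`. -/
def coloringsIn {G : SimpleGraph V} (K : (coloringComplex G).ConnectedComponent) :
    Set (Set (Set V)) :=
  {P | IsFourColoring G P ∧
    ∀ A : ColorClass G, A.1 ∈ P → (coloringComplex G).connectedComponentMk A = K}

/-! ### The graphs `Q_k` and `Q_k'` -/

/-- The vertex `(i, j)` with `i = 0, …, k + 1` is `a_i`, `b_i`, `c_i`, `d_i` for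
`j = 0, 1, 2, 3`, respectively. -/
abbrev QVertex (k : ℕ) : Type := Fin (k + 2) × ZMod 4

/-- The edges of the nested 4-cycles `D_i = a_i b_i c_i d_i`, and the edges between `D_i` and
`D_{i+1}`, which form a square antiprism: each vertex of `D_i` is joined to two consecutive
vertices of `D_{i+1}`, namely `a_i` to `a_{i+1}` and `b_{i+1}` (and so on cyclically) if `i` is
even, and `a_i` to `a_{i+1}` and `d_{i+1}` (and so on cyclically) if `i` is odd. -/
def nestedRel (k : ℕ) (x y : QVertex k) : Prop :=
  (x.1 = y.1 ∧ y.2 = x.2 + 1) ∨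
  (x.1.val + 1 = y.1.val ∧ Even x.1.val ∧ (y.2 = x.2 ∨ y.2 = x.2 + 1)) ∨
  (x.1.val + 1 = y.1.val ∧ Odd x.1.val ∧ (y.2 = x.2 ∨ y.2 = x.2 - 1))

/-- `Q_k`: the nested cycles with the edges `a_0 c_0` and `a_{k+1} c_{k+1}` added. -/
def Q (k : ℕ) : SimpleGraph (QVertex k) :=
  SimpleGraph.fromRel fun x y => nestedRel k x y ∨ (x = (0, 0) ∧ y = (0, 2)) ∨
    (x = (Fin.last (k + 1), 0) ∧ y = (Fin.last (k + 1), 2))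

/-- `Q_k'`: the nested cycles with the edges `a_0 c_0` and `b_{k+1} d_{k+1}` added. -/
def Q' (k : ℕ) : SimpleGraph (QVertex k) :=
  SimpleGraph.fromRel fun x y => nestedRel k x y ∨ (x = (0, 0) ∧ y = (0, 2)) ∨
    (x = (Fin.last (k + 1), 1) ∧ y = (Fin.last (k + 1), 3))

end TutteComplex

namespace TutteComplex

/-! ### A uniform description of the graphs -/

/-! The coloring of one layer leaves exactly two ways to color the next one (`layer_step_spiral`,
`layer_step_folded`). The inner diagonal forces at least three colors on layer 0, and the number of
colors persists outwards. With four colors, every layer carries the same cyclic order, rotated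
(`spiral`). With three, every layer has a doubled color, which alternates between the colors 1 and 3
(`folded`). In both cases a coloring is coded, up to renaming, by the parities `q i` of the position
of color 0 in layer `i`, where `q 0 = false`. For spirals the other `k + 1` parities are free. A
folded coloring must satisfy `q (k + 1) = odd4 e`, since the outer diagonal cannot join two vertices
of the doubled color (`exists_eq_perm_comp`).

Components: a class of a spiral determines `q`, and it occurs in a folded coloring only if that one
has the same `q` (`eq_of_mem_classes_spiral`, `eq_of_mem_classes_folded`). Hence the `2 ^ k` spirals
with `q (k + 1) ≠ odd4 e` are isolated, while each other spiral shares a class with a folded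
coloring (`exists_mem_coiled_banded`). In a folded coloring the class of 1 sees `q` on even layers
only and the class of 3 on odd layers only, so any two folded colorings are joined through a third
that mixes their parities (`exists_banded_between`).

Parity: modulo 2, `J` is the total number of Kempe chains. Every pair of colors forms one chain,
except possibly 1 and 3, which form two zigzag paths that only the outer diagonal can link. It links
them exactly in the isolated spirals, so the total is 6 there and 7 otherwise
(`totalKempeChains_spiral`, `totalKempeChains_folded`).

Homology degree: modulo 2 it is the sum of the vertex degrees in one color class
(`odd_facesColored_sub`). A class of an isolated spiral has one vertex per layer: degree 6 inside,
and 4 and 5, in some order, on the two end layers (`odd_sum_degree_spiral`).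

The embedding is given by an explicit map from darts to the third vertices of faces (`third_spec`),
and its genus by counting darts (`card_dart_tower`). -/

/-- The vertex `(i, j)` is joined to `(i + 1, j)` and to `(i + 1, j + slope i)`. -/
def slope (i : ℕ) : ZMod 4 := if Even i then 1 else -1

lemma slope_eq (i : ℕ) : slope i = 1 ∨ slope i = -1 := by
  unfold slope; split_ifs <;> simp

/-- The parity of a residue modulo 4. -/
def odd4 (j : ZMod 4) : Bool := decide (j = 1 ∨ j = 3)

/-- The tower of antiprisms with the inner diagonal `{(0, 0), (0, 2)}` and the outer diagonal
`{(k + 1, e), (k + 1, e + 2)}`. -/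
def tower (k : ℕ) (e : ZMod 4) : SimpleGraph (QVertex k) where
  Adj x y := (x.1 = y.1 ∧ (y.2 = x.2 + 1 ∨ x.2 = y.2 + 1)) ∨
    (x.1.val + 1 = y.1.val ∧ (y.2 = x.2 ∨ y.2 = x.2 + slope x.1)) ∨
    (y.1.val + 1 = x.1.val ∧ (x.2 = y.2 ∨ x.2 = y.2 + slope y.1)) ∨
    (x.1 = y.1 ∧ y.2 = x.2 + 2 ∧
      ((x.1.val = 0 ∧ odd4 x.2 = false) ∨ (x.1.val = k + 1 ∧ odd4 (x.2 - e) = false)))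
  symm := ⟨by
    rintro ⟨i, j⟩ ⟨i', j'⟩ (⟨h, h'⟩ | h | h | ⟨h, h', h''⟩)
    · exact Or.inl ⟨h.symm, h'.symm⟩
    · exact Or.inr (Or.inr (Or.inl h))
    · exact Or.inr (Or.inl h)
    · simp only at h h' h''
      subst h h'
      have h1 : ∀ j : ZMod 4, j = j + 2 + 2 := by decide
      have h2 : ∀ j : ZMod 4, odd4 j = false → odd4 (j + 2) = false := by decide
      refine Or.inr (Or.inr (Or.inr ⟨rfl, h1 j, ?_⟩))
      refine h''.imp (And.imp_right (h2 j)) (And.imp_right fun h => ?_)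
      have := h2 _ h
      rwa [show j - e + 2 = j + 2 - e by ring] at this⟩
  loopless := ⟨by
    rintro ⟨i, j⟩ (⟨h, h'⟩ | h | h | ⟨h, h', h''⟩)
    · have : ∀ j : ZMod 4, ¬ (j = j + 1 ∨ j = j + 1) := by decide
      exact this j h'
    · simp at h
    · simp at h
    · have : ∀ j : ZMod 4, j ≠ j + 2 := by decide
      exact this j h'⟩

lemma nestedRel_iff {k : ℕ} (x y : QVertex k) : nestedRel k x y ↔
    (x.1 = y.1 ∧ y.2 = x.2 + 1) ∨
    (x.1.val + 1 = y.1.val ∧ (y.2 = x.2 ∨ y.2 = x.2 + slope x.1)) := by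
  unfold nestedRel slope
  by_cases h : Even x.1.val
  · have h' : ¬ Odd x.1.val := by simpa using h
    simp [h, h']
  · have h' : Odd x.1.val := by simpa using h
    simp [h, h', sub_eq_add_neg]

lemma eq_tower {k : ℕ} {G : SimpleGraph (QVertex k)} (e : ZMod 4)
    (hG : G = SimpleGraph.fromRel fun x y => nestedRel k x y ∨ (x = (0, 0) ∧ y = (0, 2)) ∨
    (x = (Fin.last (k + 1), e) ∧ y = (Fin.last (k + 1), e + 2))) : G = tower k e := by
  subst hG
  ext x y
  obtain ⟨i, j⟩ := x
  obtain ⟨i', j'⟩ := y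
  constructor
  · rintro ⟨-, (h | h | h) | (h | h | h)⟩
    · rcases (nestedRel_iff _ _).1 h with h | h
      · exact Or.inl ⟨h.1, Or.inl h.2⟩
      · exact Or.inr (Or.inl h)
    · simp only [Prod.mk.injEq] at h
      obtain ⟨⟨rfl, rfl⟩, rfl, rfl⟩ := h
      exact Or.inr (Or.inr (Or.inr ⟨rfl, by simp only; decide, Or.inl ⟨rfl, by simp only; decide⟩⟩))
    · simp only [Prod.mk.injEq] at h
      obtain ⟨⟨rfl, rfl⟩, rfl, rfl⟩ := h
      refine Or.inr (Or.inr (Or.inr ⟨rfl, rfl, Or.inr ⟨rfl, ?_⟩⟩))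
      simp; decide
    · rcases (nestedRel_iff _ _).1 h with h | h
      · exact Or.inl ⟨h.1.symm, Or.inr h.2⟩
      · exact Or.inr (Or.inr (Or.inl h))
    · simp only [Prod.mk.injEq] at h
      obtain ⟨⟨rfl, rfl⟩, rfl, rfl⟩ := h
      exact Or.inr (Or.inr (Or.inr ⟨rfl, by simp only; decide, Or.inl ⟨rfl, by simp only; decide⟩⟩))
    · simp only [Prod.mk.injEq] at h
      obtain ⟨⟨rfl, rfl⟩, rfl, rfl⟩ := h
      refine Or.inr (Or.inr (Or.inr ⟨rfl, ?_, Or.inr ⟨rfl, ?_⟩⟩))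
      · simp only; revert j'; decide
      · simp; decide
  · intro h
    refine ⟨h.ne, ?_⟩
    rcases h with ⟨h, h' | h'⟩ | h | h | ⟨h, h', h'' | h''⟩
    · exact Or.inl (Or.inl ((nestedRel_iff _ _).2 (Or.inl ⟨h, h'⟩)))
    · exact Or.inr (Or.inl ((nestedRel_iff _ _).2 (Or.inl ⟨h.symm, h'⟩)))
    · exact Or.inl (Or.inl ((nestedRel_iff _ _).2 (Or.inr h)))
    · exact Or.inr (Or.inl ((nestedRel_iff _ _).2 (Or.inr h)))
    · simp only at h h' h''
      obtain rfl : i = 0 := Fin.ext h''.1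
      subst h h'
      have : j = 0 ∨ j = 2 := by
        have : ∀ j, odd4 j = false → j = 0 ∨ j = 2 := by decide
        exact this j h''.2
      rcases this with rfl | rfl
      · exact Or.inl (Or.inr (Or.inl (by simp)))
      · exact Or.inr (Or.inr (Or.inl (by simp; decide)))
    · simp only at h h' h''
      obtain rfl : i = Fin.last (k + 1) := Fin.ext h''.1
      subst h h'
      have : j = e ∨ (j = e + 2 ∧ j + 2 = e) := by
        have : ∀ j e, odd4 (j - e) = false → j = e ∨ (j = e + 2 ∧ j + 2 = e) := by decide
        exact this j e h''.2
      rcases this with rfl | ⟨h1, h2⟩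
      · exact Or.inl (Or.inr (Or.inr (by simp)))
      · exact Or.inr (Or.inr (Or.inr (by simp [h1]; simpa [h1] using h2)))

lemma tower_adj_next {k : ℕ} {e : ZMod 4} (i i' : Fin (k + 2)) (h : i.val + 1 = i'.val)
    (j j' : ZMod 4) : (tower k e).Adj (i, j) (i', j') ↔ j' = j ∨ j' = j + slope i := by
  refine ⟨?_, fun h' => Or.inr (Or.inl ⟨h, h'⟩)⟩
  rintro (h' | h' | h' | h')
  · have := congrArg Fin.val h'.1; simp only at this; omega
  · exact h'.2
  · have := h'.1; simp only at this; omega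
  · have := congrArg Fin.val h'.1; simp only at this; omega

lemma tower_adj_succ {k : ℕ} {e : ZMod 4} (i : Fin (k + 2)) (j : ZMod 4) :
    (tower k e).Adj (i, j) (i, j + 1) := Or.inl ⟨rfl, Or.inl rfl⟩

/-! ### Two families of colorings -/

/-- The residues modulo 4 as colors. -/
def hue : ZMod 4 ≃ Fin 4 := Equiv.refl (Fin 4)

/-- The positions, in the successive layers, of the vertices of the color of `(0, 0)`. The
argument prescribes the parities of these positions. -/
def track (q : ℕ → Bool) : ℕ → ZMod 4
  | 0 => 0
  -- The two rotations that `layer_step_spiral` allows: by 2, which keeps the parity, and by `-slope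
  -- i`, which changes it.
  | i + 1 => track q i + if q (i + 1) = q i then 2 else -slope i

lemma odd4_track {q : ℕ → Bool} (h : q 0 = false) (i : ℕ) : odd4 (track q i) = q i := by
  induction i with
  | zero => rw [h]; rfl
  | succ i ih =>
    rw [track, ← ih]
    generalize q (i + 1) = b
    generalize track q i = x
    rcases slope_eq i with h | h <;> rw [h] <;> revert b x <;> decide

lemma track_congr {q q' : ℕ → Bool} {n : ℕ} (h : ∀ i ≤ n, q i = q' i) :
    track q n = track q' n := by
  induction n with
  | zero => rfl
  | succ n ih =>
    rw [track, track, ih fun i hi => h i (by omega), h n (by omega), h (n + 1) le_rfl]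

lemma track_succ_cases (q : ℕ → Bool) (i : ℕ) :
    track q (i + 1) = track q i + 2 ∨ track q (i + 1) = track q i - slope i := by
  rw [track]; split_ifs
  · exact Or.inl rfl
  · exact Or.inr (sub_eq_add_neg _ _).symm

/-- The odd residues are folded to a single one, which depends on the parity of `i`. -/
def fold (i : ℕ) (x : ZMod 4) : ZMod 4 := if odd4 x then (if Even i then 1 else 3) else x

/-- Between consecutive layers a color moves by `2` or `-slope i`, whereas an edge moves by `0` or
`slope i`; these are the four residues. -/
lemma sub_track_ne {q : ℕ → Bool} {i : ℕ} {j j' : ZMod 4} (h : j' = j ∨ j' = j + slope i) :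
    j - track q i ≠ j' - track q (i + 1) := by
  have key : ∀ d x j : ZMod 4, (d = 1 ∨ d = -1) → (j - x ≠ j - (x + 2) ∧ j - x ≠ j - (x - d)) ∧
    j - x ≠ j + d - (x + 2) ∧ j - x ≠ j + d - (x - d) := by decide
  obtain ⟨⟨h1, h2⟩, h3, h4⟩ := key _ (track q i) j (slope_eq i)
  rcases track_succ_cases q i with h' | h' <;> rw [h'] <;> rcases h with h | h <;> rw [h] <;>
    assumption

lemma fold_of_even {i : ℕ} {x : ZMod 4} (h : odd4 x = false) : fold i x = x := by simp [fold, h]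

lemma odd4_fold (i : ℕ) (x : ZMod 4) : odd4 (fold i x) = odd4 x := by
  unfold fold; split_ifs with h1 h2
  · rw [h1]; rfl
  · rw [h1]; rfl
  · rfl

lemma odd4_add_one (x : ZMod 4) : odd4 (x + 1) = !odd4 x := by revert x; decide

lemma odd4_add_two (x : ZMod 4) : odd4 (x + 2) = odd4 x := by revert x; decide

lemma odd4_sub (x y : ZMod 4) : odd4 (x - y) = xor (odd4 x) (odd4 y) := by revert x y; decide

lemma add_two_ne (x : ZMod 4) : x + 2 ≠ x := by revert x; decide

/-- Odd residues fold to 1 on one layer and to 3 on the next, so folding creates no coincidence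
between consecutive layers. -/
lemma fold_ne {i : ℕ} {x y : ZMod 4} (h : x ≠ y) : fold i x ≠ fold (i + 1) y := by
  unfold fold
  by_cases hi : Even i
  · have : ¬ Even (i + 1) := by simpa [Nat.even_add_one] using hi
    simp only [hi, this, if_true, if_false]
    revert h; revert x y; decide
  · have : Even (i + 1) := by simpa [Nat.even_add_one] using hi
    simp only [hi, this, if_true, if_false]
    revert h; revert x y; decide

/-- The coloring in which each layer has all four colors, in a fixed cyclic order. -/
def spiral (k : ℕ) (e : ZMod 4) (q : ℕ → Bool) : (tower k e).Coloring (Fin 4) :=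
  SimpleGraph.Coloring.mk (fun v => hue (v.2 - track q v.1)) (by
    rintro ⟨i, j⟩ ⟨i', j'⟩ (⟨h, h'⟩ | ⟨h, h'⟩ | ⟨h, h'⟩ | ⟨h, h', -⟩) <;> simp only at h h' ⊢ <;>
      rw [hue.injective.ne_iff]
    · subst h
      generalize track q i = x
      rcases h' with rfl | rfl
      · decide +revert
      · decide +revert
    · rw [← h]; exact sub_track_ne h'
    · rw [← h]; exact (sub_track_ne h').symm
    · subst h h'
      generalize track q i = x
      decide +revert)

/-- The coloring in which each layer has three colors, and the color that is used twice alternates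
between two. -/
def folded (k : ℕ) (e : ZMod 4) (q : ℕ → Bool) (h0 : q 0 = false) (hq : q (k + 1) = odd4 e) :
    (tower k e).Coloring (Fin 4) :=
  SimpleGraph.Coloring.mk (fun v => hue (fold v.1 (v.2 - track q v.1))) (by
    rintro ⟨i, j⟩ ⟨i', j'⟩ (⟨h, h'⟩ | ⟨h, h'⟩ | ⟨h, h'⟩ | ⟨h, h', h''⟩) <;>
      simp only at h h' ⊢ <;> rw [hue.injective.ne_iff]
    · subst h
      intro h
      have := congrArg odd4 h
      rw [odd4_fold, odd4_fold] at this
      rcases h' with rfl | rfl <;> simp [odd4_sub, odd4_add_one] at this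
    · rw [← h]; exact fold_ne (sub_track_ne h')
    · rw [← h]; exact (fold_ne (sub_track_ne h')).symm
    · subst h h'
      -- The ends of the inner diagonal (by `h0`) and of the outer one (by `hq`) have even offsets,
      -- which folding does not merge.
      have : odd4 (j - track q i) = false := by
        rw [odd4_sub, odd4_track h0]
        rcases h'' with ⟨hi, hj⟩ | ⟨hi, hj⟩ <;> simp only at hi hj <;> rw [hi]
        · simp [h0, hj]
        · rwa [hq, ← odd4_sub]
      have h2 : odd4 (j + 2 - track q i) = false := by
        rw [← this, odd4_sub, odd4_sub, odd4_add_two]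
      rw [fold_of_even this, fold_of_even h2]
      simpa using (add_two_ne j).symm)

@[simp] lemma spiral_apply {k : ℕ} {e : ZMod 4} {q : ℕ → Bool} (v : QVertex k) :
    spiral k e q v = hue (v.2 - track q v.1) := rfl

@[simp] lemma folded_apply {k : ℕ} {e : ZMod 4} {q : ℕ → Bool} {h0 : q 0 = false}
    {hq : q (k + 1) = odd4 e} (v : QVertex k) :
    folded k e q h0 hq v = hue (fold v.1 (v.2 - track q v.1)) := rfl

/-! ### Classification of the colorings -/

set_option maxRecDepth 100000 in
-- The two inner neighbors of position `j` leave only `j - 2` and `j + d` for `g j`. A choice at one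
-- position forces the same choice at a cyclic neighbor, hence all around.
lemma layer_step_spiral : ∀ d : ZMod 4, d = 1 ∨ d = -1 → ∀ g : ZMod 4 → ZMod 4,
    (∀ j, g j ≠ j) → (∀ j, g (j + d) ≠ j) → (∀ j, g (j + 1) ≠ g j) →
    (∀ j, g j = j - 2) ∨ ∀ j, g j = j + d := by
  decide

set_option maxRecDepth 100000 in
-- Each new vertex sees the doubled color and one even color, so it takes the missing odd color or
-- the other even one. Properness along the cycle makes these alternate, which leaves two patterns.
lemma layer_step_folded : ∀ d : ZMod 4, d = 1 ∨ d = -1 → ∀ b : Bool, ∀ g : ZMod 4 → ZMod 4,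
    (∀ j, g j ≠ if odd4 j then (if b then 1 else 3) else j) →
    (∀ j, g (j + d) ≠ if odd4 j then (if b then 1 else 3) else j) → (∀ j, g (j + 1) ≠ g j) →
    (∀ j, g j = if odd4 (j - 2) then (if b then 3 else 1) else j - 2) ∨
      ∀ j, g j = if odd4 (j + d) then (if b then 3 else 1) else j + d := by
  decide

lemma exists_perm_fin_four : ∀ a b c : Fin 4, a ≠ b → a ≠ c → b ≠ c →
    ∃ π : Equiv.Perm (Fin 4), π (hue 0) = a ∧ π (hue 1) = b ∧ π (hue 2) = c := by
  decide

lemma track_succ_of_eq {q : ℕ → Bool} {i : ℕ} (h : q (i + 1) = q i) :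
    track q (i + 1) = track q i + 2 := by rw [track, if_pos h]

lemma track_succ_of_ne {q : ℕ → Bool} {i : ℕ} (h : q (i + 1) ≠ q i) :
    track q (i + 1) = track q i - slope i := by rw [track, if_neg h, sub_eq_add_neg]

lemma fold_eq_ite (i : ℕ) (x : ZMod 4) :
    fold i x = if odd4 x then (if decide (Even i) then 1 else 3) else x := by
  simp [fold]

lemma fold_succ_eq_ite (i : ℕ) (x : ZMod 4) :
    fold (i + 1) x = if odd4 x then (if decide (Even i) then 3 else 1) else x := by
  by_cases hi : Even i
  · have : ¬ Even (i + 1) := by simpa [Nat.even_add_one] using hi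
    simp [fold, hi, this]
  · have : Even (i + 1) := by simpa [Nat.even_add_one] using hi
    simp [fold, hi, this]

section Classification

variable {k : ℕ} {e : ZMod 4} {D : QVertex k → ZMod 4}

/-- Translation by `track q i` normalizes layer `i` so that colors are positions.
`layer_step_spiral` then leaves two options for the next layer, and the parity of the color at
position 0 selects one. -/
lemma eq_sub_track (hD : ∀ x y, (tower k e).Adj x y → D x ≠ D y) (h0 : ∀ j, D (0, j) = j)
    {q : ℕ → Bool} (hq : ∀ i : Fin (k + 2), q i = odd4 (D (i, 0))) (i : ℕ) (hi : i < k + 2)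
    (j : ZMod 4) : D (⟨i, hi⟩, j) = j - track q i := by
  induction i generalizing j with
  | zero => simpa [track] using h0 j
  | succ i ih =>
    specialize ih (by omega)
    have hadj := tower_adj_next (e := e) ⟨i, by omega⟩ ⟨i + 1, hi⟩ rfl
    have h1 := hq ⟨i, by omega⟩
    have h2 := hq ⟨i + 1, hi⟩
    simp only at h1 h2
    rw [ih] at h1
    have key := layer_step_spiral (slope i) (slope_eq i)
      (fun j => D (⟨i + 1, hi⟩, j + track q i))
      (fun j => by
        have := hD _ _ ((hadj (j + track q i) (j + track q i)).2 (Or.inl rfl))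
        rw [ih] at this
        simpa using this.symm)
      (fun j => by
        have := hD _ _ ((hadj (j + track q i) (j + slope i + track q i)).2 (Or.inr (by ring)))
        rw [ih] at this
        simpa using this.symm)
      (fun j => by
        have := hD _ _ (tower_adj_succ (e := e) ⟨i + 1, hi⟩ (j + track q i))
        rw [show j + track q i + 1 = j + 1 + track q i by ring] at this
        exact this.symm)
    rcases key with key | key
    · have h3 : ∀ j, D (⟨i + 1, hi⟩, j) = j - track q i - 2 := fun j => by
        simpa using key (j - track q i)
      rw [h3] at h2
      rw [track_succ_of_eq, h3]
      · ring
      · rw [h1, h2]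
        generalize track q i = x
        revert x; decide
    · have h3 : ∀ j, D (⟨i + 1, hi⟩, j) = j - track q i + slope i := fun j => by
        simpa using key (j - track q i)
      rw [h3] at h2
      rw [track_succ_of_ne, h3]
      · ring
      · rw [h1, h2]
        generalize track q i = x
        rcases slope_eq i with h | h <;> rw [h] <;> revert x <;> decide

lemma eq_fold_sub_track (hD : ∀ x y, (tower k e).Adj x y → D x ≠ D y)
    (h0 : ∀ j, D (0, j) = fold 0 j)
    {q : ℕ → Bool} (hq : ∀ i : Fin (k + 2), q i = odd4 (D (i, 0))) (i : ℕ) (hi : i < k + 2)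
    (j : ZMod 4) : D (⟨i, hi⟩, j) = fold i (j - track q i) := by
  induction i generalizing j with
  | zero => simpa [track] using h0 j
  | succ i ih =>
    specialize ih (by omega)
    have hadj := tower_adj_next (e := e) ⟨i, by omega⟩ ⟨i + 1, hi⟩ rfl
    have h1 := hq ⟨i, by omega⟩
    have h2 := hq ⟨i + 1, hi⟩
    simp only at h1 h2
    rw [ih, odd4_fold] at h1
    have key := layer_step_folded (slope i) (slope_eq i) (decide (Even i))
      (fun j => D (⟨i + 1, hi⟩, j + track q i))
      (fun j => by
        have := hD _ _ ((hadj (j + track q i) (j + track q i)).2 (Or.inl rfl))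
        rw [ih, fold_eq_ite] at this
        simpa using this.symm)
      (fun j => by
        have := hD _ _ ((hadj (j + track q i) (j + slope i + track q i)).2 (Or.inr (by ring)))
        rw [ih, fold_eq_ite] at this
        simpa using this.symm)
      (fun j => by
        have := hD _ _ (tower_adj_succ (e := e) ⟨i + 1, hi⟩ (j + track q i))
        rw [show j + track q i + 1 = j + 1 + track q i by ring] at this
        exact this.symm)
    simp only [← fold_succ_eq_ite] at key
    rcases key with key | key
    · have h3 : ∀ j, D (⟨i + 1, hi⟩, j) = fold (i + 1) (j - track q i - 2) := fun j => by
        simpa using key (j - track q i)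
      rw [h3, odd4_fold] at h2
      rw [track_succ_of_eq, h3]
      · congr 1; ring
      · rw [h1, h2]
        generalize track q i = x
        revert x; decide
    · have h3 : ∀ j, D (⟨i + 1, hi⟩, j) = fold (i + 1) (j - track q i + slope i) := fun j => by
        simpa using key (j - track q i)
      rw [h3, odd4_fold] at h2
      rw [track_succ_of_ne, h3]
      · congr 1; ring
      · rw [h1, h2]
        generalize track q i = x
        rcases slope_eq i with h | h <;> rw [h] <;> revert x <;> decide

end Classification

lemma zmod_four_cases (j : ZMod 4) : j = 0 ∨ j = 1 ∨ j = 2 ∨ j = 3 := by revert j; decide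

theorem exists_eq_perm_comp {k : ℕ} {e : ZMod 4} (C : (tower k e).Coloring (Fin 4)) :
    ∃ (π : Equiv.Perm (Fin 4)) (q : ℕ → Bool) (h0 : q 0 = false),
      (∀ v, C v = π (spiral k e q v)) ∨
        ∃ hq : q (k + 1) = odd4 e, ∀ v, C v = π (folded k e q h0 hq v) := by
  have a01 : C (0, 0) ≠ C (0, 1) := C.valid (tower_adj_succ 0 0)
  have a12 : C (0, 1) ≠ C (0, 2) := C.valid (tower_adj_succ 0 1)
  have a23 : C (0, 2) ≠ C (0, 3) := C.valid (tower_adj_succ 0 2)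
  have a30 : C (0, 3) ≠ C (0, 0) := C.valid (tower_adj_succ 0 3)
  have a02 : C (0, 0) ≠ C (0, 2) :=
    C.valid (Or.inr (Or.inr (Or.inr ⟨rfl, by simp, Or.inl ⟨rfl, by simp only; decide⟩⟩)))
  obtain ⟨π, p0, p1, p2⟩ := exists_perm_fin_four _ _ _ a01 a02 a12
  let D : QVertex k → ZMod 4 := fun v => hue.symm (π.symm (C v))
  have hC : ∀ v, C v = π (hue (D v)) := fun v => by simp [D]
  have hD : ∀ x y, (tower k e).Adj x y → D x ≠ D y := fun x y h h' => by
    apply C.valid h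
    rw [hC, hC, h']
  have inj : ∀ v j, C v = π (hue j) → D v = j := fun v j h => by simp [D, h]
  have d0 := inj _ _ p0.symm
  have d1 := inj _ _ p1.symm
  have d2 := inj _ _ p2.symm
  have d3 : D (0, 3) = 1 ∨ D (0, 3) = 3 := by
    have h1 : D (0, 3) ≠ 0 := fun h => a30 (by rw [hC, h, p0])
    have h2 : D (0, 3) ≠ 2 := fun h => a23 (by rw [hC (0, 3), h, p2])
    rcases zmod_four_cases (D (0, 3)) with h | h | h | h
    exacts [absurd h h1, Or.inl h, absurd h h2, Or.inr h]
  -- The color at position 0 will be `-track q i` up to folding, which has the parity of `track q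
  -- i`. The value beyond the last layer plays no role.
  let q : ℕ → Bool := fun i => if h : i < k + 2 then odd4 (D (⟨i, h⟩, 0)) else false
  have hq : ∀ i : Fin (k + 2), q i = odd4 (D (i, 0)) := fun i => by simp [q]
  have q0 : q 0 = false := by
    have := hq 0
    rw [d0] at this
    exact this
  refine ⟨π, q, q0, ?_⟩
  rcases d3 with d3 | d3
  · right
    have h := eq_fold_sub_track hD (fun j => by
      rcases zmod_four_cases j with rfl | rfl | rfl | rfl
      · rw [d0]; rfl
      · rw [d1]; rfl
      · rw [d2]; rfl
      · rw [d3]; rfl) hq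
    refine ⟨?_, fun v => by rw [hC, folded_apply]; congr 2; exact h _ v.1.2 _⟩
    -- With the wrong parity, both ends of the outer diagonal would carry the doubled color.
    by_contra hne
    have h3 : odd4 (e - track q (k + 1)) = true := by
      rw [odd4_sub, odd4_track q0]
      revert hne; cases q (k + 1) <;> cases odd4 e <;> simp
    refine hD (Fin.last (k + 1), e) (Fin.last (k + 1), e + 2)
      (Or.inr (Or.inr (Or.inr ⟨rfl, rfl, Or.inr ⟨rfl, by simp; rfl⟩⟩))) ?_
    have h4 : odd4 (e + 2 - track q (k + 1)) = true := by
      rw [← h3, odd4_sub, odd4_sub, odd4_add_two]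
    have e1 := h (k + 1) (by omega) e
    have e2 := h (k + 1) (by omega) (e + 2)
    rw [fold, if_pos h3] at e1
    rw [fold, if_pos h4] at e2
    exact e1.trans e2.symm
  · left
    have h := eq_sub_track hD (fun j => by
      rcases zmod_four_cases j with rfl | rfl | rfl | rfl <;> assumption) hq
    exact fun v => by rw [hC, spiral_apply]; congr 2; exact h _ v.1.2 _

/-! ### Color classes -/

section Classes

variable {V : Type*} {G : SimpleGraph V}

lemma classes_eq_of_perm {C C' : G.Coloring (Fin 4)} (π : Equiv.Perm (Fin 4))
    (h : ∀ v, C v = π (C' v)) : classes C = classes C' := by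
  have key : ∀ a, C.colorClass (π a) = C'.colorClass a := fun a => by
    ext v; simp [SimpleGraph.Coloring.colorClass, h]
  ext A
  constructor
  · rintro ⟨a, rfl⟩
    exact ⟨π.symm a, by rw [← key]; simp⟩
  · rintro ⟨a, rfl⟩
    exact ⟨π a, key a⟩

/-- Surjectivity makes the classes of `C'` nonempty; being disjoint, they are then distinct, so
matching equal classes defines an injection of the colors. -/
lemma exists_perm_of_classes_eq {C C' : G.Coloring (Fin 4)} (hC' : Function.Surjective C')
    (h : classes C = classes C') : ∃ π : Equiv.Perm (Fin 4), ∀ v, C v = π (C' v) := by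
  have h1 : ∀ a, ∃ b, C.colorClass b = C'.colorClass a := fun a => by
    have : C'.colorClass a ∈ classes C := h ▸ ⟨a, rfl⟩
    exact this
  choose f hf using h1
  have hv : ∀ v, C v = f (C' v) := fun v => by
    have : v ∈ C.colorClass (f (C' v)) := by rw [hf]; rfl
    exact this
  have hinj : Function.Injective f := fun a b hab => by
    obtain ⟨v, rfl⟩ := hC' a
    have : v ∈ C'.colorClass b := by rw [← hf, ← hab, hf]; rfl
    exact this
  exact ⟨Equiv.ofBijective f (Finite.injective_iff_bijective.1 hinj), hv⟩

end Classes

/-! ### Parametrization of the colorings -/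

/-- The sequence of parities `false, t 0, …, t (k - 1), xor b (odd4 e)`. -/
def parities {k : ℕ} (e : ZMod 4) (t : Fin k → Bool) (b : Bool) (i : ℕ) : Bool :=
  if i = 0 then false else if h : i - 1 < k then t ⟨i - 1, h⟩ else xor b (odd4 e)

section Parities

variable {k : ℕ} {e : ZMod 4}

lemma parities_zero (t : Fin k → Bool) (b : Bool) : parities e t b 0 = false := rfl

lemma parities_last (t : Fin k → Bool) (b : Bool) :
    parities e t b (k + 1) = xor b (odd4 e) := by simp [parities]

lemma parities_succ (t : Fin k → Bool) (b : Bool) (i : Fin k) :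
    parities e t b (i + 1) = t i := by simp [parities]

lemma exists_parities (q : ℕ → Bool) (h0 : q 0 = false) :
    ∀ i ≤ k + 1, q i = parities e (fun i : Fin k => q (i + 1)) (xor (q (k + 1)) (odd4 e)) i := by
  intro i hi
  rcases i with _ | i
  · exact h0
  · rcases (show i < k ∨ i = k by omega) with h | rfl
    · exact (parities_succ (e := e) (fun i : Fin k => q (i + 1)) _ ⟨i, h⟩).symm
    · rw [parities_last]; simp

lemma parities_inj {t t' : Fin k → Bool} {b b' : Bool}
    (h : ∀ i ≤ k + 1, parities e t b i = parities e t' b' i) : t = t' ∧ b = b' := by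
  constructor
  · ext i
    have := h (i + 1) (by omega)
    rwa [parities_succ, parities_succ] at this
  · have := h (k + 1) le_rfl
    rw [parities_last, parities_last] at this
    simpa using this

/-- The colorings with four colors on each layer. -/
abbrev coiled (e : ZMod 4) (t : Fin k → Bool) (b : Bool) : (tower k e).Coloring (Fin 4) :=
  spiral k e (parities e t b)

/-- The colorings with three colors on each layer. -/
abbrev banded (e : ZMod 4) (t : Fin k → Bool) : (tower k e).Coloring (Fin 4) :=
  folded k e (parities e t false) (parities_zero _ _) (by rw [parities_last]; simp)

lemma mem_classes_spiral {q : ℕ → Bool} {A : Set (QVertex k)} :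
    A ∈ classes (spiral k e q) ↔ ∃ m : ZMod 4, ∀ v, v ∈ A ↔ v.2 = track q v.1 + m := by
  have key : ∀ (m : ZMod 4) (v : QVertex k), v ∈ (spiral k e q).colorClass (hue m) ↔
      v.2 = track q v.1 + m := fun m v => by
    change hue _ = hue m ↔ _
    rw [hue.injective.eq_iff, sub_eq_iff_eq_add']
  constructor
  · rintro ⟨a, rfl⟩
    exact ⟨hue.symm a, fun v => by rw [← key]; simp⟩
  · rintro ⟨m, hm⟩
    exact ⟨hue m, by ext v; rw [hm, key]⟩

lemma mem_classes_folded {q : ℕ → Bool} {h0 : q 0 = false} {hq : q (k + 1) = odd4 e}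
    {A : Set (QVertex k)} : A ∈ classes (folded k e q h0 hq) ↔
      ∃ m : ZMod 4, ∀ v, v ∈ A ↔ fold v.1 (v.2 - track q v.1) = m := by
  constructor
  · rintro ⟨a, rfl⟩
    exact ⟨hue.symm a, fun v => by rw [Equiv.eq_symm_apply]; rfl⟩
  · rintro ⟨m, hm⟩
    exact ⟨hue m, by ext v; rw [hm, ← hue.injective.eq_iff]; rfl⟩

lemma eq_of_track_eq {q q' : ℕ → Bool} (h0 : q 0 = false) (h0' : q' 0 = false)
    (h : ∀ i : Fin (k + 2), track q i = track q' i) : ∀ i ≤ k + 1, q i = q' i := fun i hi => by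
  rw [← odd4_track h0 i, ← odd4_track h0' i, h ⟨i, by omega⟩]

/-- Tracks start at 0, so layer 0 reveals the color `m` of the class. The other layers then reveal
the track, whose parities are `q`. -/
lemma eq_of_mem_classes_spiral {q q' : ℕ → Bool} (h0 : q 0 = false) (h0' : q' 0 = false)
    {A : Set (QVertex k)} (h : A ∈ classes (spiral k e q)) (h' : A ∈ classes (spiral k e q')) :
    ∀ i ≤ k + 1, q i = q' i := by
  obtain ⟨m, hm⟩ := mem_classes_spiral.1 h
  obtain ⟨n, hn⟩ := mem_classes_spiral.1 h'
  have h1 : m = n := by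
    simpa [track] using (hn (0, m)).1 ((hm (0, m)).2 (by simp [track]))
  subst h1
  refine eq_of_track_eq h0 h0' fun i => ?_
  have := (hn (i, track q i + m)).1 ((hm _).2 rfl)
  exact add_right_cancel this

/-- A spiral class has exactly one vertex on layer 0, whereas the odd colors of a folded coloring
have two or none there. So the shared class has an even color, unaffected by folding, and the tracks
agree. -/
lemma eq_of_mem_classes_folded {q q' : ℕ → Bool} (h0 : q 0 = false) {h0' : q' 0 = false}
    {hq' : q' (k + 1) = odd4 e} {A : Set (QVertex k)} (h : A ∈ classes (spiral k e q))
    (h' : A ∈ classes (folded k e q' h0' hq')) : ∀ i ≤ k + 1, q i = q' i := by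
  obtain ⟨m, hm⟩ := mem_classes_spiral.1 h
  obtain ⟨n, hn⟩ := mem_classes_folded.1 h'
  have hmn : ∀ j : ZMod 4, j = m ↔ fold 0 j = n := fun j => by
    simpa [track] using (hm (0, j)).symm.trans (hn (0, j))
  have h1 : odd4 m = false := by
    by_contra h1
    have h1 : odd4 m = true := by simpa using h1
    have h2 := (hmn m).1 rfl
    refine add_two_ne m ((hmn _).2 ?_)
    rw [← h2, fold, fold, odd4_add_two, if_pos h1, if_pos h1]
  have h2 := (hmn m).1 rfl
  rw [fold_of_even h1] at h2
  subst h2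
  refine eq_of_track_eq h0 h0' fun i => ?_
  have h3 := (hn (i, track q i + m)).1 ((hm _).2 rfl)
  have h4 : odd4 (track q i + m - track q' i) = false := by
    rw [← h1, ← odd4_fold i, h3]
  simp only at h3
  rw [fold_of_even h4] at h3
  linear_combination h3

lemma classes_spiral_congr {q q' : ℕ → Bool} (h : ∀ i ≤ k + 1, q i = q' i) :
    classes (spiral k e q) = classes (spiral k e q') :=
  classes_eq_of_perm (Equiv.refl _) fun v => by
    have : track q v.1 = track q' v.1 := track_congr fun i hi => h i (by omega)
    simp [this]

lemma classes_folded_congr {q q' : ℕ → Bool} {h0 : q 0 = false} {hq : q (k + 1) = odd4 e}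
    {h0' : q' 0 = false} {hq' : q' (k + 1) = odd4 e} (h : ∀ i ≤ k + 1, q i = q' i) :
    classes (folded k e q h0 hq) = classes (folded k e q' h0' hq') :=
  classes_eq_of_perm (Equiv.refl _) fun v => by
    have : track q v.1 = track q' v.1 := track_congr fun i hi => h i (by omega)
    simp [this]

theorem isFourColoring_iff {P : Set (Set (QVertex k))} : IsFourColoring (tower k e) P ↔
    (∃ t b, P = classes (coiled e t b)) ∨ ∃ t, P = classes (banded e t) := by
  constructor
  · rintro ⟨C, rfl⟩
    obtain ⟨π, q, h0, h | ⟨hq, h⟩⟩ := exists_eq_perm_comp C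
    · exact Or.inl ⟨_, _, (classes_eq_of_perm π h).trans
        (classes_spiral_congr (exists_parities q h0))⟩
    · refine Or.inr ⟨fun i => q (i + 1), (classes_eq_of_perm π h).trans
        (classes_folded_congr fun i hi => ?_)⟩
      have := exists_parities (e := e) q h0 i hi
      rwa [hq, Bool.xor_self] at this
  · rintro (⟨t, b, rfl⟩ | ⟨t, rfl⟩)
    exacts [⟨_, rfl⟩, ⟨_, rfl⟩]

/-- A color class of an isolated coloring determines the coloring. -/
theorem eq_classes_coiled_of_mem {P : Set (Set (QVertex k))} {A : Set (QVertex k)}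
    {t : Fin k → Bool} (hA : A ∈ classes (coiled e t true)) (hP : IsFourColoring (tower k e) P)
    (hAP : A ∈ P) : P = classes (coiled e t true) := by
  obtain ⟨t', b, rfl⟩ | ⟨t', rfl⟩ := isFourColoring_iff.1 hP
  · obtain ⟨rfl, rfl⟩ := parities_inj (eq_of_mem_classes_spiral rfl rfl hA hAP)
    rfl
  · have := (parities_inj (eq_of_mem_classes_folded rfl hA hAP)).2
    simp at this

/-- Folding fixes even residues, so the class of color 0 is common to both. -/
lemma exists_mem_coiled_banded (t : Fin k → Bool) :
    ∃ A, A ∈ classes (coiled e t false) ∧ A ∈ classes (banded e t) := by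
  refine ⟨{v | v.2 = track (parities e t false) v.1 + 0}, mem_classes_spiral.2 ⟨0, fun v => Iff.rfl⟩,
    mem_classes_folded.2 ⟨0, fun v => ?_⟩⟩
  have key : ∀ i x, x = 0 ↔ fold i x = 0 := fun i x => by
    constructor
    · rintro rfl; exact fold_of_even rfl
    · intro h
      have : odd4 x = false := by rw [← odd4_fold i, h]; rfl
      rwa [fold_of_even this] at h
  rw [← key, Set.mem_ofPred_eq, add_zero, sub_eq_zero]

lemma fold_eq_one_iff {i : ℕ} {x : ZMod 4} : fold i x = 1 ↔ Even i ∧ odd4 x = true := by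
  unfold fold
  split_ifs with h1 h2
  · simp [h1, h2]
  · simp only [h2, false_and, iff_false]; decide
  · simp only [h1]
    revert h1; revert x; simp; decide

lemma fold_eq_three_iff {i : ℕ} {x : ZMod 4} : fold i x = 3 ↔ ¬ Even i ∧ odd4 x = true := by
  unfold fold
  split_ifs with h1 h2
  · simp only [h2, not_true, false_and, iff_false]; decide
  · simp [h1, h2]
  · simp only [h1]
    revert h1; revert x; simp; decide

/-- The class of color 1 consists of the odd offsets on the even layers, and the parity of an offset
depends on the track only through `q`. -/
lemma exists_mem_banded_one {q q' : ℕ → Bool} {h0 : q 0 = false} {hq : q (k + 1) = odd4 e}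
    {h0' : q' 0 = false} {hq' : q' (k + 1) = odd4 e} (h : ∀ i, Even i → q i = q' i) :
    ∃ A, A ∈ classes (folded k e q h0 hq) ∧ A ∈ classes (folded k e q' h0' hq') := by
  refine ⟨_, mem_classes_folded.2 ⟨1, fun v => Iff.rfl⟩, mem_classes_folded.2 ⟨1, fun v => ?_⟩⟩
  change _ = _ ↔ _
  rw [fold_eq_one_iff, fold_eq_one_iff, odd4_sub, odd4_sub, odd4_track h0, odd4_track h0']
  exact and_congr_right fun hi => by rw [h _ hi]

lemma exists_mem_banded_three {q q' : ℕ → Bool} {h0 : q 0 = false} {hq : q (k + 1) = odd4 e}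
    {h0' : q' 0 = false} {hq' : q' (k + 1) = odd4 e} (h : ∀ i, ¬ Even i → q i = q' i) :
    ∃ A, A ∈ classes (folded k e q h0 hq) ∧ A ∈ classes (folded k e q' h0' hq') := by
  refine ⟨_, mem_classes_folded.2 ⟨3, fun v => Iff.rfl⟩, mem_classes_folded.2 ⟨3, fun v => ?_⟩⟩
  change _ = _ ↔ _
  rw [fold_eq_three_iff, fold_eq_three_iff, odd4_sub, odd4_sub, odd4_track h0, odd4_track h0']
  exact and_congr_right fun hi => by rw [h _ hi]

lemma exists_banded_between (t t' : Fin k → Bool) : ∃ s : Fin k → Bool,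
    (∃ A, A ∈ classes (banded e t) ∧ A ∈ classes (banded e s)) ∧
    ∃ A, A ∈ classes (banded e s) ∧ A ∈ classes (banded e t') := by
  -- The entry `t i` is the parity on layer `i + 1`, hence the shift.
  let s : Fin k → Bool := fun i => if Even (i.val + 1) then t i else t' i
  have hs : ∀ i, parities e s false i =
      if Even i then parities e t false i else parities e t' false i := by
    intro i
    unfold parities
    rcases i with _ | i
    · simp
    · by_cases hi : i < k <;> simp [hi, s]
  exact ⟨s, exists_mem_banded_one fun i hi => by rw [hs, if_pos hi],
    exists_mem_banded_three fun i hi => by rw [hs, if_neg hi]⟩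

end Parities

/-! ### The components of the coloring complex -/

lemma reachable_of_mem {V : Type*} {G : SimpleGraph V} {P : Set (Set V)} (hP : IsFourColoring G P)
    {A B : ColorClass G} (hA : A.1 ∈ P) (hB : B.1 ∈ P) : (coloringComplex G).Reachable A B := by
  by_cases h : A = B
  · rw [h]
  · exact SimpleGraph.Adj.reachable ⟨h, P, hP, hA, hB⟩

/-- The color class `a` of `C`, as a vertex of the coloring complex. -/
def classVertex {V : Type*} {G : SimpleGraph V} (C : G.Coloring (Fin 4)) (a : Fin 4) :
    ColorClass G := ⟨C.colorClass a, _, ⟨C, rfl⟩, a, rfl⟩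

lemma classVertex_mem {V : Type*} {G : SimpleGraph V} (C : G.Coloring (Fin 4)) (a : Fin 4) :
    (classVertex C a).1 ∈ classes C := ⟨a, rfl⟩

section Components

variable {k : ℕ} {e : ZMod 4}

/-- By `eq_classes_coiled_of_mem`, every edge at a class of an isolated coloring comes from that
coloring, so no walk leaves it. -/
lemma mem_classes_of_reachable {t : Fin k → Bool} {A B : ColorClass (tower k e)}
    (h : (coloringComplex (tower k e)).Reachable A B) (hA : A.1 ∈ classes (coiled e t true)) :
    B.1 ∈ classes (coiled e t true) := by
  obtain ⟨w⟩ := h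
  induction w with
  | nil => exact hA
  | cons hadj _ ih =>
    obtain ⟨-, P, hP, h1, h2⟩ := hadj
    rw [eq_classes_coiled_of_mem hA hP h1] at h2
    exact ih h2

variable (e) in
/-- The component of an isolated coloring. -/
def isolatedComponent (t : Fin k → Bool) : (coloringComplex (tower k e)).ConnectedComponent :=
  (coloringComplex (tower k e)).connectedComponentMk (classVertex (coiled e t true) 0)

variable (k e) in
/-- The component of the other colorings. -/
def mainComponent : (coloringComplex (tower k e)).ConnectedComponent :=
  (coloringComplex (tower k e)).connectedComponentMk (classVertex (banded e fun _ => false) 0)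

lemma mk_eq_isolatedComponent {t : Fin k → Bool} {A : ColorClass (tower k e)} :
    (coloringComplex (tower k e)).connectedComponentMk A = isolatedComponent e t ↔
      A.1 ∈ classes (coiled e t true) := by
  rw [isolatedComponent, SimpleGraph.ConnectedComponent.eq]
  exact ⟨fun h => mem_classes_of_reachable h.symm (classVertex_mem _ _),
    fun h => reachable_of_mem ⟨_, rfl⟩ h (classVertex_mem _ _)⟩

lemma reachable_of_common {V : Type*} {G : SimpleGraph V} {P P' : Set (Set V)}
    (hP : IsFourColoring G P) (hP' : IsFourColoring G P') (h : ∃ A, A ∈ P ∧ A ∈ P')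
    {A B : ColorClass G} (hA : A.1 ∈ P) (hB : B.1 ∈ P') :
    (coloringComplex G).Reachable A B := by
  obtain ⟨X, hX, hX'⟩ := h
  exact (reachable_of_mem hP hA (B := ⟨X, _, hP, hX⟩) hX).trans
    (reachable_of_mem hP' (A := ⟨X, _, hP, hX⟩) hX' hB)

lemma mk_eq_mainComponent_of_mem_banded {t : Fin k → Bool} {A : ColorClass (tower k e)}
    (hA : A.1 ∈ classes (banded e t)) :
    (coloringComplex (tower k e)).connectedComponentMk A = mainComponent k e := by
  obtain ⟨s, h1, h2⟩ := exists_banded_between (e := e) t fun _ => false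
  rw [mainComponent, SimpleGraph.ConnectedComponent.eq]
  exact (reachable_of_common ⟨_, rfl⟩ ⟨_, rfl⟩ h1 hA (classVertex_mem (banded e s) 0)).trans
    (reachable_of_common ⟨_, rfl⟩ ⟨_, rfl⟩ h2 (classVertex_mem _ 0) (classVertex_mem _ 0))

lemma mk_eq_mainComponent_of_mem_coiled {t : Fin k → Bool} {A : ColorClass (tower k e)}
    (hA : A.1 ∈ classes (coiled e t false)) :
    (coloringComplex (tower k e)).connectedComponentMk A = mainComponent k e := by
  rw [← mk_eq_mainComponent_of_mem_banded (classVertex_mem (banded e t) 0),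
    SimpleGraph.ConnectedComponent.eq]
  exact reachable_of_common ⟨_, rfl⟩ ⟨_, rfl⟩ (exists_mem_coiled_banded t) hA
    (classVertex_mem _ _)

lemma isolatedComponent_ne_mainComponent (t : Fin k → Bool) :
    isolatedComponent e t ≠ mainComponent k e := by
  intro h
  have h1 := classVertex_mem (banded (k := k) e fun _ => false) 0
  have h2 := mk_eq_isolatedComponent.1 h.symm
  have := (parities_inj (eq_of_mem_classes_folded rfl h2 h1)).2
  simp at this

lemma isolatedComponent_injective : Function.Injective (isolatedComponent (k := k) e) := by
  intro t t' h
  exact (parities_inj (eq_of_mem_classes_spiral rfl rfl (mk_eq_isolatedComponent.1 h)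
    (classVertex_mem _ _))).1.symm

lemma eq_mainComponent_or (K : (coloringComplex (tower k e)).ConnectedComponent) :
    K = mainComponent k e ∨ ∃ t, K = isolatedComponent e t := by
  induction K using SimpleGraph.ConnectedComponent.ind with | h A => ?_
  obtain ⟨P, hP, hA⟩ := A.2
  obtain ⟨t, b, rfl⟩ | ⟨t, rfl⟩ := isFourColoring_iff.1 hP
  · cases b
    · exact Or.inl (mk_eq_mainComponent_of_mem_coiled hA)
    · exact Or.inr ⟨t, mk_eq_isolatedComponent.2 hA⟩
  · exact Or.inl (mk_eq_mainComponent_of_mem_banded hA)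

theorem card_components :
    Nat.card (coloringComplex (tower k e)).ConnectedComponent = 2 ^ k + 1 := by
  let F : Option (Fin k → Bool) → (coloringComplex (tower k e)).ConnectedComponent :=
    fun o => o.elim (mainComponent k e) (isolatedComponent e)
  have hF : Function.Bijective F := by
    constructor
    · rintro (_ | t) (_ | t') h
      · rfl
      · exact absurd h.symm (isolatedComponent_ne_mainComponent t')
      · exact absurd h (isolatedComponent_ne_mainComponent t)
      · exact congrArg some (isolatedComponent_injective h)
    · intro K
      obtain rfl | ⟨t, rfl⟩ := eq_mainComponent_or K
      exacts [⟨none, rfl⟩, ⟨some t, rfl⟩]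
  rw [← Nat.card_eq_of_bijective F hF]
  simp

lemma classes_nonempty_of_isFourColoring {V : Type*} {G : SimpleGraph V} {P : Set (Set V)}
    (h : IsFourColoring G P) : ∃ A : ColorClass G, A.1 ∈ P := by
  obtain ⟨C, rfl⟩ := h
  exact ⟨classVertex C 0, classVertex_mem C 0⟩

theorem coloringsIn_isolatedComponent (t : Fin k → Bool) :
    coloringsIn (isolatedComponent e t) = {classes (coiled e t true)} := by
  ext P
  constructor
  · rintro ⟨hP, h⟩
    obtain ⟨A, hA⟩ := classes_nonempty_of_isFourColoring hP
    exact eq_classes_coiled_of_mem (mk_eq_isolatedComponent.1 (h A hA)) hP hA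
  · rintro rfl
    exact ⟨⟨_, rfl⟩, fun A hA => mk_eq_isolatedComponent.2 hA⟩

theorem mem_coloringsIn_mainComponent {P : Set (Set (QVertex k))} :
    P ∈ coloringsIn (mainComponent k e) ↔
      (∃ t, P = classes (coiled e t false)) ∨ ∃ t, P = classes (banded e t) := by
  constructor
  · rintro ⟨hP, h⟩
    obtain ⟨t, b, rfl⟩ | ⟨t, rfl⟩ := isFourColoring_iff.1 hP
    · cases b
      · exact Or.inl ⟨t, rfl⟩
      · exact absurd (h _ (classVertex_mem _ 0)) (isolatedComponent_ne_mainComponent t)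
    · exact Or.inr ⟨t, rfl⟩
  · rintro (⟨t, rfl⟩ | ⟨t, rfl⟩)
    · exact ⟨⟨_, rfl⟩, fun A hA => mk_eq_mainComponent_of_mem_coiled hA⟩
    · exact ⟨⟨_, rfl⟩, fun A hA => mk_eq_mainComponent_of_mem_banded hA⟩

/-- The vertices `(0, 1)` and `(0, 3)` have different colors in the spiral and the same color in the
folded coloring. -/
lemma classes_coiled_ne_classes_banded (t t' : Fin k → Bool) (b : Bool) :
    classes (coiled e t b) ≠ classes (banded e t') := by
  intro h
  have h1 : {v : QVertex k | v.2 = track (parities e t b) v.1 + 1} ∈ classes (coiled e t b) :=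
    mem_classes_spiral.2 ⟨1, fun v => Iff.rfl⟩
  rw [h] at h1
  obtain ⟨m, hm⟩ := mem_classes_folded.1 h1
  have h2 := (hm (0, 1)).1 (by simp [track])
  have h3 := (hm (0, 3)).2 (by rw [← h2]; simp [track]; rfl)
  simp [track] at h3
  revert h3; decide

theorem ncard_coloringsIn_mainComponent :
    (coloringsIn (mainComponent k e)).ncard = 2 ^ (k + 1) := by
  let F : (Fin k → Bool) × Bool → Set (Set (QVertex k)) :=
    fun x => if x.2 then classes (coiled e x.1 false) else classes (banded e x.1)
  have hF : Function.Injective F := by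
    rintro ⟨t, b⟩ ⟨t', b'⟩ h
    obtain ⟨A, hA, hA'⟩ := exists_mem_coiled_banded (e := e) t
    cases b <;> cases b' <;> simp only [F, if_true, if_false, Bool.false_eq_true] at h
    · rw [h] at hA'
      rw [(parities_inj (eq_of_mem_classes_folded rfl hA hA')).1]
    · exact absurd h.symm (classes_coiled_ne_classes_banded _ _ _)
    · exact absurd h (classes_coiled_ne_classes_banded _ _ _)
    · have hA2 := hA
      rw [h] at hA2
      rw [(parities_inj (eq_of_mem_classes_spiral rfl rfl hA hA2)).1]
  have : coloringsIn (mainComponent k e) = Set.range F := by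
    ext P
    rw [mem_coloringsIn_mainComponent]
    constructor
    · rintro (⟨t, rfl⟩ | ⟨t, rfl⟩)
      exacts [⟨(t, true), rfl⟩, ⟨(t, false), rfl⟩]
    · rintro ⟨⟨t, b⟩, rfl⟩
      cases b
      exacts [Or.inr ⟨t, rfl⟩, Or.inl ⟨t, rfl⟩]
  rw [this, ← Set.image_univ, Set.ncard_image_of_injective _ hF, Set.ncard_univ]
  simp [pow_succ]

end Components

/-! ### Kempe chains and parity -/

section Kempe

variable {V : Type*} {G : SimpleGraph V}

lemma kempeChains_comm (C : G.Coloring (Fin 4)) (a b : Fin 4) :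
    kempeChains C a b = kempeChains C b a := by
  unfold kempeChains; rw [Set.union_comm]

lemma kempeChains_congr {C C' : G.Coloring (Fin 4)} {a b a' b' : Fin 4}
    (h : ∀ v, C v = a ∨ C v = b ↔ C' v = a' ∨ C' v = b') :
    kempeChains C a b = kempeChains C' a' b' := by
  have : C.colorClass a ∪ C.colorClass b = C'.colorClass a' ∪ C'.colorClass b' := by
    ext v; exact h v
  unfold kempeChains; rw [this]

/-- The number of Kempe chains for all pairs of colors. -/
noncomputable def totalKempeChains (C : G.Coloring (Fin 4)) : ℕ :=
  kempeChains C 0 1 + kempeChains C 0 2 + kempeChains C 0 3 + kempeChains C 1 2 +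
    kempeChains C 1 3 + kempeChains C 2 3

/-- The sum over ordered pairs makes invariance under renaming a mere reindexing. -/
lemma two_mul_totalKempeChains (C : G.Coloring (Fin 4)) :
    2 * totalKempeChains C = ∑ x : Fin 4, ∑ y : Fin 4, if x = y then 0 else kempeChains C x y := by
  simp [Fin.sum_univ_four, totalKempeChains, kempeChains_comm C 1 0, kempeChains_comm C 2 0,
    kempeChains_comm C 3 0, kempeChains_comm C 2 1, kempeChains_comm C 3 1, kempeChains_comm C 3 2]
  ring

lemma totalKempeChains_eq_of_perm {C C' : G.Coloring (Fin 4)} (π : Equiv.Perm (Fin 4))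
    (h : ∀ v, C v = π (C' v)) : totalKempeChains C = totalKempeChains C' := by
  have key : ∀ x y, kempeChains C (π x) (π y) = kempeChains C' x y := fun x y =>
    kempeChains_congr fun v => by simp [h]
  have h2 : 2 * totalKempeChains C = 2 * totalKempeChains C' := by
    rw [two_mul_totalKempeChains, two_mul_totalKempeChains, ← Equiv.sum_comp π]
    refine Finset.sum_congr rfl fun x _ => ?_
    rw [← Equiv.sum_comp π]
    simp [key]
  omega

/-- Signs do not matter modulo 2, so the parity of `J` is that of the sum over all six pairs,
whatever `a` is. -/
lemma exists_J_eq (C : G.Coloring (Fin 4)) (a : Fin 4) :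
    ∃ m : ℤ, J C a = 2 * m - totalKempeChains C := by
  refine ⟨∑ b ∈ Finset.univ.filter (fun b : Fin 4 => b ≠ a), (kempeChains C a b : ℤ), ?_⟩
  fin_cases a <;>
  simp [J, Finset.sum_filter, Fintype.sum_prod_type, Fin.sum_univ_four, totalKempeChains,
    kempeChains_comm C 1 0, kempeChains_comm C 2 0,
    kempeChains_comm C 3 0, kempeChains_comm C 2 1, kempeChains_comm C 3 1, kempeChains_comm C 3 2]
    <;> ring

lemma even_J_iff (C : G.Coloring (Fin 4)) (a : Fin 4) :
    Even (J C a) ↔ Even (totalKempeChains C) := by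
  obtain ⟨m, hm⟩ := exists_J_eq C a
  rw [hm, Int.even_sub]
  simp

/-- `u` and `v` are joined by a path in the subgraph induced on `X`. -/
def Linked (G : SimpleGraph V) (X : Set V) (u v : V) : Prop :=
  ∃ (hu : u ∈ X) (hv : v ∈ X), (G.induce X).Reachable ⟨u, hu⟩ ⟨v, hv⟩

lemma Linked.symm {X : Set V} {u v : V} : Linked G X u v → Linked G X v u :=
  fun ⟨hu, hv, h⟩ => ⟨hv, hu, h.symm⟩

lemma Linked.trans {X : Set V} {u v w : V} : Linked G X u v → Linked G X v w → Linked G X u w :=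
  fun ⟨hu, _, h⟩ ⟨_, hw, h'⟩ => ⟨hu, hw, h.trans h'⟩

lemma Linked.refl {X : Set V} {u : V} (hu : u ∈ X) : Linked G X u u := ⟨hu, hu, .refl _⟩

lemma Linked.of_adj {X : Set V} {u v : V} (hu : u ∈ X) (hv : v ∈ X) (h : G.Adj u v) :
    Linked G X u v :=
  ⟨hu, hv, SimpleGraph.Adj.reachable (G := G.induce X) (u := ⟨u, hu⟩) (v := ⟨v, hv⟩) h⟩

/-- A label `f` that is constant along edges, with a representative `z i` of each label to which all
vertices of that label are linked, identifies the components with the labels. -/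
lemma card_components_induce {X : Set V} {ι : Type*} (f : V → ι)
    (h1 : ∀ u ∈ X, ∀ v ∈ X, G.Adj u v → f u = f v) (z : ι → V) (hz : ∀ i, z i ∈ X)
    (hf : ∀ i, f (z i) = i) (h2 : ∀ u ∈ X, Linked G X u (z (f u))) :
    Nat.card (G.induce X).ConnectedComponent = Nat.card ι := by
  symm
  have hr : ∀ u v : X, (G.induce X).Reachable u v → f u = f v := by
    rintro u v ⟨w⟩
    induction w with
    | nil => rfl
    | cons h _ ih => exact (h1 _ (Subtype.property _) _ (Subtype.property _) h).trans ih
  refine Nat.card_eq_of_bijective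
    (fun i => (G.induce X).connectedComponentMk ⟨z i, hz i⟩) ⟨fun i j hij => ?_, fun K => ?_⟩
  · have := hr _ _ (SimpleGraph.ConnectedComponent.eq.1 hij)
    rwa [hf, hf] at this
  · induction K using SimpleGraph.ConnectedComponent.ind with | h u => ?_
    obtain ⟨_, _, h⟩ := h2 u.1 u.2
    exact ⟨f u, SimpleGraph.ConnectedComponent.eq.2 h.symm⟩

lemma card_components_induce_eq_one {X : Set V} (z : V) (hz : z ∈ X)
    (h : ∀ u ∈ X, Linked G X u z) : Nat.card (G.induce X).ConnectedComponent = 1 := by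
  rw [card_components_induce (ι := Unit) (fun _ => ()) (fun _ _ _ _ _ => rfl) (fun _ => z)
    (fun _ => hz) (fun _ => rfl) h]
  simp

end Kempe

/-! ### Kempe chains of the spiral and folded colorings -/

section TowerKempe

variable {k : ℕ} {e : ZMod 4}

lemma linked_zero {X : Set (QVertex k)} {p : ℕ → ZMod 4} (h0 : (0, p 0) ∈ X)
    (h : ∀ i (hi : i + 1 < k + 2), Linked (tower k e) X (⟨i + 1, hi⟩, p (i + 1))
      (⟨i, by omega⟩, p i)) (i : Fin (k + 2)) : Linked (tower k e) X (i, p i) (0, p 0) := by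
  obtain ⟨i, hi⟩ := i
  induction i with
  | zero => exact Linked.refl h0
  | succ i ih => exact (h i hi).trans (ih (by omega))

lemma spiral_eq_hue_iff {q : ℕ → Bool} {v : QVertex k} {m : ZMod 4} :
    spiral k e q v = hue m ↔ v.2 = track q v.1 + m := by
  rw [spiral_apply, hue.injective.eq_iff, sub_eq_iff_eq_add']

/-- On each layer the two colors occupy adjacent positions, and some edge joins these pairs on
consecutive layers: the chain is a ladder. -/
lemma kempeChains_spiral_succ (q : ℕ → Bool) (x : ZMod 4) :
    kempeChains (spiral k e q) (hue x) (hue (x + 1)) = 1 := by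
  set X := (spiral k e q).colorClass (hue x) ∪ (spiral k e q).colorClass (hue (x + 1)) with hX
  have mem : ∀ v, v ∈ X ↔ v.2 = track q v.1 + x ∨ v.2 = track q v.1 + (x + 1) := fun v => by
    rw [← spiral_eq_hue_iff, ← spiral_eq_hue_iff]; rfl
  have m1 : ∀ i : Fin (k + 2), (i, track q i + x) ∈ X := fun i => (mem _).2 (Or.inl rfl)
  have m2 : ∀ i : Fin (k + 2), (i, track q i + (x + 1)) ∈ X := fun i => (mem _).2 (Or.inr rfl)
  have rung : ∀ i : Fin (k + 2),
      Linked (tower k e) X (i, track q i + (x + 1)) (i, track q i + x) := fun i =>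
    (Linked.of_adj (m1 i) (m2 i) (by rw [← add_assoc]; exact tower_adj_succ _ _)).symm
  have hl := linked_zero (e := e) (p := fun i => track q i + x) (m1 0) fun i hi => by
    have hadj := tower_adj_next (e := e) ⟨i, by omega⟩ ⟨i + 1, hi⟩ rfl
    have key : ∀ d t t' x : ZMod 4, (d = 1 ∨ d = -1) → (t' = t + 2 ∨ t' = t - d) →
      (t' + (x + 1) = t + x ∨ t' + (x + 1) = t + x + d) ∨
      (t' + x = t + (x + 1) ∨ t' + x = t + (x + 1) + d) := by decide
    rcases key _ _ _ x (slope_eq i) (track_succ_cases q i) with h | h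
    · exact (rung _).symm.trans (Linked.of_adj (m1 _) (m2 ⟨i + 1, hi⟩) ((hadj _ _).2 h)).symm
    · exact (Linked.of_adj (m2 _) (m1 ⟨i + 1, hi⟩) ((hadj _ _).2 h)).symm.trans (rung _)
  refine card_components_induce_eq_one (0, track q 0 + x) (m1 0) ?_
  rintro ⟨i, j⟩ h
  replace h := (mem _).1 h
  simp only at h
  rcases h with rfl | rfl
  · exact hl i
  · exact (rung i).trans (hl i)

/-- The colors `x` and `x + 2` of a spiral coloring form two zigzag paths; this is the position
of the path `b` in the layer `i`. -/
def zigzag (q : ℕ → Bool) (x : ZMod 4) (b : Bool) (i : ℕ) : ZMod 4 :=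
  track q i + x + if xor b i.bodd then 2 else 0

lemma eq_zigzag_iff {q : ℕ → Bool} {x : ZMod 4} {i : ℕ} {j : ZMod 4} :
    j = track q i + x ∨ j = track q i + (x + 2) ↔ ∃ b, j = zigzag q x b i := by
  simp only [zigzag, Bool.exists_bool]
  cases i.bodd <;> simp [add_assoc, or_comm]

/-- From a vertex of color `x`, exactly one of the two edges outwards stays within the colors `x`,
`x + 2`, and it leads to the other color. This is why `zigzag` alternates with the parity of the
layer. -/
lemma zigzag_succ {q : ℕ → Bool} {x : ZMod 4} {b b' : Bool} {i : ℕ} :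
    (zigzag q x b' (i + 1) = zigzag q x b i ∨ zigzag q x b' (i + 1) = zigzag q x b i + slope i) ↔
      b' = b := by
  have key : ∀ (d t t' x : ZMod 4) (b b' c : Bool), (d = 1 ∨ d = -1) →
    (t' = t + 2 ∨ t' = t - d) → ((t' + x + (if xor b' (!c) then 2 else 0) =
        t + x + (if xor b c then 2 else 0) ∨ t' + x + (if xor b' (!c) then 2 else 0) =
        t + x + (if xor b c then 2 else 0) + d) ↔ b' = b) := by decide
  rw [zigzag, zigzag, Nat.bodd_succ]
  exact key _ _ _ _ _ _ _ (slope_eq i) (track_succ_cases q i)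

lemma zigzag_not (q : ℕ → Bool) (x : ZMod 4) (b : Bool) (i : ℕ) :
    zigzag q x (!b) i = zigzag q x b i + 2 := by
  unfold zigzag
  generalize track q i + x = y
  cases b <;> cases i.bodd <;> simp <;> revert y <;> decide

lemma zigzag_injective (q : ℕ → Bool) (x : ZMod 4) (i : ℕ) :
    Function.Injective fun b => zigzag q x b i := by
  intro b b' h
  by_contra hb
  obtain rfl : b' = !b := by revert hb; cases b <;> cases b' <;> simp
  simp only [zigzag_not] at h
  exact add_two_ne _ h.symm

lemma odd4_zigzag {q : ℕ → Bool} (h0 : q 0 = false) (x : ZMod 4) (b : Bool) (i : ℕ) :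
    odd4 (zigzag q x b i) = xor (q i) (odd4 x) := by
  have key : ∀ (t x : ZMod 4) (c : Bool), odd4 (t + x + if c then 2 else 0) =
    xor (odd4 t) (odd4 x) := by decide
  rw [zigzag, key, odd4_track h0]

/-- The vertices of the colors `x` and `x + 2` in a spiral coloring. -/
def zigzags (k : ℕ) (q : ℕ → Bool) (x : ZMod 4) : Set (QVertex k) :=
  {v | ∃ b, v.2 = zigzag q x b v.1}

lemma zigzag_mem (q : ℕ → Bool) (x : ZMod 4) (b : Bool) (i : Fin (k + 2)) :
    (i, zigzag q x b i) ∈ zigzags k q x := ⟨b, rfl⟩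

lemma kempeChains_spiral_add_two (q : ℕ → Bool) (x : ZMod 4) :
    kempeChains (spiral k e q) (hue x) (hue (x + 2)) =
      Nat.card ((tower k e).induce (zigzags k q x)).ConnectedComponent := by
  have : (spiral k e q).colorClass (hue x) ∪ (spiral k e q).colorClass (hue (x + 2)) =
      zigzags k q x := by
    ext v
    change spiral k e q v = _ ∨ spiral k e q v = _ ↔ _
    rw [spiral_eq_hue_iff, spiral_eq_hue_iff, eq_zigzag_iff]; rfl
  rw [kempeChains, this]

lemma linked_zigzag (q : ℕ → Bool) (x : ZMod 4) (b : Bool) (i : Fin (k + 2)) :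
    Linked (tower k e) (zigzags k q x) (i, zigzag q x b i) (0, zigzag q x b 0) := by
  refine linked_zero (e := e) (p := zigzag q x b) (zigzag_mem q x b 0) (fun i hi => ?_) i
  exact (Linked.of_adj (zigzag_mem q x b ⟨i, by omega⟩) (zigzag_mem q x b ⟨i + 1, hi⟩)
    ((tower_adj_next ⟨i, by omega⟩ ⟨i + 1, hi⟩ rfl _ _).2 (zigzag_succ.2 rfl))).symm

lemma card_zigzags_eq_one {q : ℕ → Bool} {x : ZMod 4} (i : Fin (k + 2))
    (h : (tower k e).Adj (i, zigzag q x false i) (i, zigzag q x true i)) :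
    Nat.card ((tower k e).induce (zigzags k q x)).ConnectedComponent = 1 := by
  refine card_components_induce_eq_one (0, zigzag q x false 0) (zigzag_mem q x false 0) ?_
  rintro ⟨i', j⟩ ⟨b, h'⟩
  simp only at h'
  subst h'
  cases b
  · exact linked_zigzag _ _ _ _
  · exact ((linked_zigzag _ _ _ _).trans (linked_zigzag _ _ _ i).symm).trans
      ((Linked.of_adj (zigzag_mem q x false i) (zigzag_mem q x true i) h).symm.trans (linked_zigzag _ _ _ i))

lemma card_zigzags_of_even {q : ℕ → Bool} (h0 : q 0 = false) {x : ZMod 4} (hx : odd4 x = false) :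
    Nat.card ((tower k e).induce (zigzags k q x)).ConnectedComponent = 1 := by
  refine card_zigzags_eq_one 0 (Or.inr (Or.inr (Or.inr ⟨rfl, zigzag_not q x false 0,
    Or.inl ⟨rfl, ?_⟩⟩)))
  have := odd4_zigzag h0 x false 0
  rw [h0, hx] at this
  exact this

/-- On the last layer both zigzags have the parity opposite to `q (k + 1)`, which is that of `e`, so
the outer diagonal links them. -/
lemma card_zigzags_of_odd {q : ℕ → Bool} (h0 : q 0 = false) {x : ZMod 4} (hx : odd4 x = true)
    (hq : q (k + 1) ≠ odd4 e) :
    Nat.card ((tower k e).induce (zigzags k q x)).ConnectedComponent = 1 := by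
  refine card_zigzags_eq_one (Fin.last _) (Or.inr (Or.inr (Or.inr ⟨rfl, zigzag_not q x false _,
    Or.inr ⟨rfl, ?_⟩⟩)))
  simp only [odd4_sub, Fin.val_last, odd4_zigzag h0, hx]
  revert hq; cases q (k + 1) <;> cases odd4 e <;> simp

/-- On each layer the two zigzags have positions of equal parity, so no cycle edge joins them. Both
diagonals have the other parity, and edges between layers stay on one path by `zigzag_succ`. -/
lemma card_zigzags_eq_two {q : ℕ → Bool} (h0 : q 0 = false) {x : ZMod 4} (hx : odd4 x = true)
    (hq : q (k + 1) = odd4 e) :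
    Nat.card ((tower k e).induce (zigzags k q x)).ConnectedComponent = 2 := by
  have hf : ∀ i b, decide (zigzag q x b i = zigzag q x true i) = b := fun i b => by
    have : zigzag q x b i = zigzag q x true i ↔ b = true := (zigzag_injective q x i).eq_iff
    simp [this]
  rw [card_components_induce (ι := Bool) (fun v => decide (v.2 = zigzag q x true v.1)) ?_
    (fun b => (0, zigzag q x b 0)) (fun b => zigzag_mem q x b 0) (fun b => hf 0 b) ?_]
  · simp
  · rintro ⟨i, j⟩ ⟨b, h⟩ ⟨i', j'⟩ ⟨b', h'⟩ hadj
    change j = zigzag q x b i at h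
    change j' = zigzag q x b' i' at h'
    subst h h'
    change decide (zigzag q x b i = _) = decide (zigzag q x b' i' = _)
    rw [hf, hf]
    rcases hadj with ⟨h, h'⟩ | ⟨h, h'⟩ | ⟨h, h'⟩ | ⟨h, -, ⟨h', h''⟩ | ⟨h', h''⟩⟩ <;>
      simp only at h h'
    · subst h
      have h1 := odd4_zigzag h0 x b i
      have h2 := odd4_zigzag h0 x b' i
      rcases h' with h' | h'
      · rw [h', odd4_add_one, h1] at h2; simp at h2
      · rw [h', odd4_add_one, h2] at h1; simp at h1
    · rw [← h] at h'
      exact (zigzag_succ.1 h').symm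
    · rw [← h] at h'
      exact zigzag_succ.1 h'
    · simp [odd4_zigzag h0, h', hx, h0] at h''
    · simp [odd4_sub, odd4_zigzag h0, h', hx, hq] at h''
  · rintro ⟨i, j⟩ ⟨b, h⟩
    simp only at h
    subst h
    change Linked _ _ _ (0, zigzag q x (decide (zigzag q x b i = _)) 0)
    rw [hf]
    exact linked_zigzag _ _ _ _

/-- The even color `x` has one vertex per layer. The odd color `m` is doubled on every second layer,
where both its vertices are adjacent to the `x`-vertex. Of two consecutive layers one carries `m`,
and through it their `x`-vertices are linked. -/
lemma kempeChains_folded_of_odd {q : ℕ → Bool} {h0 : q 0 = false} {hq : q (k + 1) = odd4 e}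
    {x m : ZMod 4} (hx : odd4 x = false) (hm : odd4 m = true) :
    kempeChains (folded k e q h0 hq) (hue x) (hue m) = 1 := by
  set X := (folded k e q h0 hq).colorClass (hue x) ∪ (folded k e q h0 hq).colorClass (hue m)
    with hX
  have mem : ∀ v, v ∈ X ↔ v.2 = track q v.1 + x ∨
      (odd4 (v.2 - track q v.1) = true ∧ m = if Even v.1.val then 1 else 3) := fun v => by
    change hue _ = hue x ∨ hue _ = hue m ↔ _
    rw [hue.injective.eq_iff, hue.injective.eq_iff]
    by_cases h : odd4 (v.2 - track q v.1) = true
    · have h1 : v.2 ≠ track q v.1 + x := fun h1 => by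
        rw [h1, add_sub_cancel_left, hx] at h; simp at h
      have h2 : fold v.1 (v.2 - track q v.1) ≠ x := fun h2 => by
        rw [← odd4_fold v.1, h2, hx] at h; simp at h
      simp only [h1, h2, h, false_or, true_and]
      rw [fold, if_pos h, eq_comm]
    · have h' : odd4 (v.2 - track q v.1) = false := by simpa using h
      have h1 : v.2 - track q v.1 ≠ m := fun h1 => h (h1 ▸ hm)
      rw [fold_of_even h']
      simp [h, h1, sub_eq_iff_eq_add']
  have m1 : ∀ i : Fin (k + 2), (i, track q i + x) ∈ X := fun i => (mem _).2 (Or.inl rfl)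
  have spoke : ∀ i : Fin (k + 2), ∀ j, odd4 (j - track q i) = true →
      (m = if Even i.val then 1 else 3) →
      (i, j) ∈ X ∧ Linked (tower k e) X (i, j) (i, track q i + x) := fun i j hj hi => by
    have mj : (i, j) ∈ X := (mem _).2 (Or.inr ⟨hj, hi⟩)
    refine ⟨mj, Linked.of_adj mj (m1 i) (Or.inl ⟨rfl, ?_⟩)⟩
    have key : ∀ j t x, odd4 x = false → odd4 (j - t) = true → t + x = j + 1 ∨ j = t + x + 1 := by
      decide
    exact key _ _ _ hx hj
  have hl := linked_zero (e := e) (p := fun i => track q i + x) (m1 0) fun i hi => by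
    have hadj := tower_adj_next (e := e) ⟨i, by omega⟩ ⟨i + 1, hi⟩ rfl
    by_cases hm' : m = if Even i then 1 else 3
    · have key : ∀ d t t' x : ZMod 4, (d = 1 ∨ d = -1) → (t' = t + 2 ∨ t' = t - d) →
        odd4 x = false → ∃ j, odd4 (j - t) = true ∧ (t' + x = j ∨ t' + x = j + d) := by decide
      obtain ⟨j, h1, h2⟩ := key _ _ _ x (slope_eq i) (track_succ_cases q i) hx
      obtain ⟨h3, h4⟩ := spoke ⟨i, by omega⟩ j h1 hm'
      exact (Linked.of_adj h3 (m1 ⟨i + 1, hi⟩) ((hadj _ _).2 h2)).symm.trans h4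
    · have hm' : m = if Even (i + 1) then 1 else 3 := by
        have : m = 1 ∨ m = 3 := by simpa [odd4] using hm
        by_cases hi : Even i
        · simp_all [Nat.even_add_one]
        · simp_all
      have key : ∀ d t t' x : ZMod 4, (d = 1 ∨ d = -1) → (t' = t + 2 ∨ t' = t - d) →
        odd4 x = false → ∃ j, odd4 (j - t') = true ∧ (j = t + x ∨ j = t + x + d) := by decide
      obtain ⟨j, h1, h2⟩ := key _ _ _ x (slope_eq i) (track_succ_cases q i) hx
      obtain ⟨h3, h4⟩ := spoke ⟨i + 1, hi⟩ j h1 hm'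
      exact h4.symm.trans (Linked.of_adj (m1 ⟨i, by omega⟩) h3 ((hadj _ _).2 h2)).symm
  refine card_components_induce_eq_one (0, track q 0 + x) (m1 0) ?_
  rintro ⟨i, j⟩ h
  replace h := (mem _).1 h
  simp only at h
  rcases h with rfl | ⟨h1, h2⟩
  · exact hl i
  · exact (spoke i j h1 h2).2.trans (hl i)

lemma totalKempeChains_spiral {q : ℕ → Bool} (h0 : q 0 = false) :
    totalKempeChains (spiral k e q) = if q (k + 1) = odd4 e then 7 else 6 := by
  have h01 : kempeChains (spiral k e q) 0 1 = 1 := kempeChains_spiral_succ q 0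
  have h12 : kempeChains (spiral k e q) 1 2 = 1 := kempeChains_spiral_succ q 1
  have h23 : kempeChains (spiral k e q) 2 3 = 1 := kempeChains_spiral_succ q 2
  have h30 : kempeChains (spiral k e q) 3 0 = 1 := kempeChains_spiral_succ q 3
  have h02 : kempeChains (spiral k e q) 0 2 = 1 :=
    (kempeChains_spiral_add_two q 0).trans (card_zigzags_of_even h0 rfl)
  have h13 : kempeChains (spiral k e q) 1 3 = if q (k + 1) = odd4 e then 2 else 1 := by
    refine (kempeChains_spiral_add_two q 1).trans ?_
    split_ifs with h
    exacts [card_zigzags_eq_two h0 rfl h, card_zigzags_of_odd h0 rfl h]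
  rw [totalKempeChains, h01, h02, kempeChains_comm _ 0 3, h30, h12, h13, h23]
  split_ifs <;> rfl

lemma totalKempeChains_folded {q : ℕ → Bool} (h0 : q 0 = false) (hq : q (k + 1) = odd4 e) :
    totalKempeChains (folded k e q h0 hq) = 7 := by
  have h01 : kempeChains (folded k e q h0 hq) 0 1 = 1 :=
    kempeChains_folded_of_odd (x := 0) (m := 1) rfl rfl
  have h03 : kempeChains (folded k e q h0 hq) 0 3 = 1 :=
    kempeChains_folded_of_odd (x := 0) (m := 3) rfl rfl
  have h21 : kempeChains (folded k e q h0 hq) 2 1 = 1 :=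
    kempeChains_folded_of_odd (x := 2) (m := 1) rfl rfl
  have h23 : kempeChains (folded k e q h0 hq) 2 3 = 1 :=
    kempeChains_folded_of_odd (x := 2) (m := 3) rfl rfl
  -- Folding preserves the sets {0, 2} and {1, 3}, so these two Kempe subgraphs are those of the
  -- spiral with the same `q`.
  have key : ∀ (b : Bool) (x : ZMod 4),
      ((if odd4 x then (if b then (1 : ZMod 4) else 3) else x) = 0 ∨
        (if odd4 x then (if b then (1 : ZMod 4) else 3) else x) = 2 ↔ x = 0 ∨ x = 2) ∧
      ((if odd4 x then (if b then (1 : ZMod 4) else 3) else x) = 1 ∨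
        (if odd4 x then (if b then (1 : ZMod 4) else 3) else x) = 3 ↔ x = 1 ∨ x = 3) := by decide
  have h02 : kempeChains (folded k e q h0 hq) 0 2 = 1 := by
    refine (kempeChains_congr (C' := spiral k e q) (a' := hue 0) (b' := hue (0 + 2)) ?_).trans
      ((kempeChains_spiral_add_two q 0).trans (card_zigzags_of_even h0 rfl))
    intro v
    have := (key (decide (Even v.1.val)) (v.2 - track q v.1)).1
    rw [← fold_eq_ite] at this
    exact this
  have h13 : kempeChains (folded k e q h0 hq) 1 3 = 2 := by
    refine (kempeChains_congr (C' := spiral k e q) (a' := hue 1) (b' := hue (1 + 2)) ?_).trans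
      ((kempeChains_spiral_add_two q 1).trans (card_zigzags_eq_two h0 rfl hq))
    intro v
    have := (key (decide (Even v.1.val)) (v.2 - track q v.1)).2
    rw [← fold_eq_ite] at this
    exact this
  rw [totalKempeChains, h01, h02, h03, kempeChains_comm _ 1 2, h21, h13, h23]

lemma hue_surjective_of {C : (tower k e).Coloring (Fin 4)} (h : ∀ m, ∃ v, C v = hue m) :
    Function.Surjective C := fun a => by simpa using h (hue.symm a)

lemma spiral_surjective (q : ℕ → Bool) : Function.Surjective (spiral k e q) :=
  hue_surjective_of fun m => ⟨(0, m), by simp [track]⟩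

lemma folded_surjective {q : ℕ → Bool} {h0 : q 0 = false} {hq : q (k + 1) = odd4 e} :
    Function.Surjective (folded k e q h0 hq) := by
  refine hue_surjective_of fun m => ?_
  rcases zmod_four_cases m with rfl | rfl | rfl | rfl
  · exact ⟨(0, 0), by simp [track]; rfl⟩
  · exact ⟨(0, 1), by simp [track]; rfl⟩
  · exact ⟨(0, 2), by simp [track]; rfl⟩
  -- The color 3 is absent from layer 0 and first occurs on layer 1.
  · exact ⟨(1, track q 1 + 1), by simp; rfl⟩

theorem isOddColoring_of_eq {V : Type*} {G : SimpleGraph V} {C' : G.Coloring (Fin 4)}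
    (hs : Function.Surjective C') (h : Odd (totalKempeChains C')) :
    IsOddColoring G (classes C') := by
  refine ⟨⟨C', rfl⟩, fun C hC a => ?_⟩
  obtain ⟨π, hπ⟩ := exists_perm_of_classes_eq hs hC
  rwa [← Int.not_even_iff_odd, even_J_iff, totalKempeChains_eq_of_perm π hπ, Nat.not_even_iff_odd]

theorem isEvenColoring_of_eq {V : Type*} {G : SimpleGraph V} {C' : G.Coloring (Fin 4)}
    (hs : Function.Surjective C') (h : Even (totalKempeChains C')) :
    IsEvenColoring G (classes C') := by
  refine ⟨⟨C', rfl⟩, fun C hC a => ?_⟩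
  obtain ⟨π, hπ⟩ := exists_perm_of_classes_eq hs hC
  rwa [even_J_iff, totalKempeChains_eq_of_perm π hπ]

theorem isEvenColoring_coiled (t : Fin k → Bool) :
    IsEvenColoring (tower k e) (classes (coiled e t true)) :=
  isEvenColoring_of_eq (spiral_surjective _) (by
    rw [totalKempeChains_spiral (parities_zero _ _), parities_last]
    simp; decide)

theorem isOddColoring_coiled (t : Fin k → Bool) :
    IsOddColoring (tower k e) (classes (coiled e t false)) :=
  isOddColoring_of_eq (spiral_surjective _) (by
    rw [totalKempeChains_spiral (parities_zero _ _), parities_last]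
    simp; decide)

theorem isOddColoring_banded (t : Fin k → Bool) :
    IsOddColoring (tower k e) (classes (banded e t)) :=
  isOddColoring_of_eq folded_surjective (by rw [totalKempeChains_folded]; decide)

end TowerKempe

/-! ### Connectivity -/

section Connectivity

variable {k : ℕ} {e : ZMod 4}

lemma exists_layer_subsingleton {S : Finset (QVertex k)} (hS : S.card < 4) {i i' : Fin (k + 2)}
    (h : i ≠ i') : (∀ j j', (i, j) ∈ S → (i, j') ∈ S → j = j') ∨
      ∀ j j', (i', j) ∈ S → (i', j') ∈ S → j = j' := by
  by_contra! hne
  obtain ⟨⟨a, b, ha, hb, hab⟩, c, d, hc, hd, hcd⟩ := hne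
  have hsub : ({(i, a), (i, b), (i', c), (i', d)} : Finset (QVertex k)) ⊆ S := by
    intro x hx
    simp only [Finset.mem_insert, Finset.mem_singleton] at hx
    rcases hx with rfl | rfl | rfl | rfl <;> assumption
  have := Finset.card_le_card hsub
  rw [Finset.card_insert_of_notMem, Finset.card_insert_of_notMem, Finset.card_pair] at this
  · omega
  · simp [hcd]
  · simp [h]
  · simp [h, hab]

lemma linked_of_layer_subsingleton {S : Finset (QVertex k)} {i : Fin (k + 2)}
    (hi : ∀ j j', (i, j) ∈ S → (i, j') ∈ S → j = j') {j j' : ZMod 4} (hj : (i, j) ∉ S)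
    (hj' : (i, j') ∉ S) : Linked (tower k e) (S : Set (QVertex k))ᶜ (i, j) (i, j') := by
  have step : ∀ j, (i, j) ∉ S → (i, j + 1) ∉ S →
      Linked (tower k e) (S : Set (QVertex k))ᶜ (i, j) (i, j + 1) := fun j h h' =>
    Linked.of_adj (by simpa using h) (by simpa using h') (tower_adj_succ _ _)
  have key : ∀ j j' : ZMod 4, j' = j ∨ j' = j + 1 ∨ j = j' + 1 ∨
      (j' = j + 1 + 1 ∧ j = j' + 1 + 1 ∧ j + 1 ≠ j' + 1) := by decide
  rcases key j j' with rfl | rfl | rfl | ⟨h1, h2, h3⟩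
  · exact Linked.refl (by simpa using hj)
  · exact step _ hj hj'
  · exact (step _ hj' hj).symm
  · by_cases h : (i, j + 1) ∈ S
    · have h' : (i, j' + 1) ∉ S := fun h' => h3 (hi _ _ h h')
      have := (step _ h' (by rwa [← h2]))
      rw [← h2] at this
      exact ((step _ hj' h').trans this).symm
    · have := (step _ h (by rwa [← h1]))
      rw [← h1] at this
      exact (step _ hj h).trans this

/-- A 4-cycle that loses at most one vertex stays connected, and every vertex of the other layer
keeps one of its two neighbors there. -/
lemma linked_of_layers {S : Finset (QVertex k)} {i i' : Fin (k + 2)}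
    (hi : ∀ j j', (i, j) ∈ S → (i, j') ∈ S → j = j')
    (hn : ∀ j, ∃ a b, a ≠ b ∧ (tower k e).Adj (i, a) (i', j) ∧ (tower k e).Adj (i, b) (i', j))
    {u v : QVertex k} (hu : u ∉ S) (hv : v ∉ S) (hui : u.1 = i ∨ u.1 = i')
    (hvi : v.1 = i ∨ v.1 = i') : Linked (tower k e) (S : Set (QVertex k))ᶜ u v := by
  have key : ∀ u ∉ S, u.1 = i ∨ u.1 = i' →
      ∃ j, (i, j) ∉ S ∧ Linked (tower k e) (S : Set (QVertex k))ᶜ u (i, j) := by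
    rintro ⟨i₀, j⟩ hu (h | h) <;> simp only at h <;> subst h
    · exact ⟨j, hu, Linked.refl (by simpa using hu)⟩
    · obtain ⟨a, b, hab, ha, hb⟩ := hn j
      by_cases h : (i, a) ∈ S
      · have h' : (i, b) ∉ S := fun h' => hab (hi _ _ h h')
        exact ⟨b, h', Linked.of_adj (by simpa using hu) (by simpa using h') hb.symm⟩
      · exact ⟨a, h, Linked.of_adj (by simpa using hu) (by simpa using h) ha.symm⟩
  obtain ⟨a, ha, hua⟩ := key u hu hui
  obtain ⟨b, hb, hvb⟩ := key v hv hvi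
  exact (hua.trans (linked_of_layer_subsingleton hi ha hb)).trans hvb.symm

lemma linked_of_consecutive {S : Finset (QVertex k)} (hS : S.card < 4) {i i' : Fin (k + 2)}
    (h : i.val + 1 = i'.val) {u v : QVertex k} (hu : u ∉ S) (hv : v ∉ S)
    (hui : u.1 = i ∨ u.1 = i') (hvi : v.1 = i ∨ v.1 = i') :
    Linked (tower k e) (S : Set (QVertex k))ᶜ u v := by
  have hs : ∀ j : ZMod 4, j ≠ j + slope i := fun j => by
    have : ∀ d j : ZMod 4, d = 1 ∨ d = -1 → j ≠ j + d := by decide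
    exact this _ j (slope_eq _)
  rcases exists_layer_subsingleton hS (i := i) (i' := i') (by rintro rfl; omega) with hi | hi
  · refine linked_of_layers hi (fun j => ⟨j, j - slope i, ?_, ?_, ?_⟩) hu hv hui hvi
    · simpa using (hs (j - slope i)).symm
    · exact (tower_adj_next _ _ h _ _).2 (Or.inl rfl)
    · exact (tower_adj_next _ _ h _ _).2 (Or.inr (by ring))
  · refine linked_of_layers hi (fun j => ⟨j, j + slope i, hs j, ?_, ?_⟩) hu hv hui.symm hvi.symm
    · exact ((tower_adj_next _ _ h _ _).2 (Or.inl rfl)).symm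
    · exact ((tower_adj_next _ _ h _ _).2 (Or.inr rfl)).symm

/-- Three deletions cannot exhaust a layer, nor remove two vertices from each of two layers. So each
pair of consecutive layers stays connected, and these pairs overlap in surviving vertices. -/
theorem isVertexConnected_tower : IsVertexConnected 4 (tower k e) := by
  refine ⟨by simp; omega, fun S hS => ?_⟩
  have hp : ∀ i : Fin (k + 2), ∃ j, (i, j) ∉ S := fun i => by
    by_contra! h
    have hsub : Finset.univ.image (fun j : ZMod 4 => (i, j)) ⊆ S := by
      intro x hx
      obtain ⟨j, -, rfl⟩ := Finset.mem_image.1 hx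
      exact h j
    have := Finset.card_le_card hsub
    rw [Finset.card_image_of_injective _ (fun a b h => (Prod.mk.inj h).2)] at this
    simp at this
    omega
  choose p hp using hp
  have hl := linked_zero (e := e) (X := (S : Set (QVertex k))ᶜ)
    (p := fun i => if h : i < k + 2 then p ⟨i, h⟩ else 0) (by simpa using hp 0)
    (fun i hi => by
      have hi' : i < k + 2 := by omega
      simp only [hi, hi', dif_pos]
      exact linked_of_consecutive hS (i := ⟨i, hi'⟩) (i' := ⟨i + 1, hi⟩) rfl (hp _) (hp _)
        (Or.inr rfl) (Or.inl rfl))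
  simp only [Fin.is_lt, dif_pos, Fin.eta] at hl
  have hall : ∀ u ∉ S, Linked (tower k e) (S : Set (QVertex k))ᶜ u (0, p 0) := by
    rintro ⟨i, j⟩ hu
    refine Linked.trans ?_ (by simpa using hl i)
    by_cases hi : i.val + 1 < k + 2
    · exact linked_of_consecutive hS (i := i) (i' := ⟨i + 1, hi⟩) rfl hu (hp i)
        (Or.inl rfl) (Or.inl rfl)
    · exact linked_of_consecutive hS (i := ⟨i - 1, by omega⟩) (i' := i) (by simp; omega) hu (hp i)
        (Or.inr rfl) (Or.inr rfl)
  rw [SimpleGraph.connected_iff]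
  refine ⟨fun u v => ?_, ⟨⟨(0, p 0), by simpa using hp 0⟩⟩⟩
  obtain ⟨_, _, h⟩ := (hall u.1 fun h => u.2 (Finset.mem_coe.2 h)).trans (hall v.1 fun h => v.2 (Finset.mem_coe.2 h)).symm
  exact h

lemma IsVertexConnected.connected {V : Type*} {G : SimpleGraph V} {m : ℕ} (hm : 0 < m)
    (h : IsVertexConnected m G) : G.Connected := by
  have h1 := h.2 ∅ (by simpa using hm)
  rw [SimpleGraph.connected_iff] at h1 ⊢
  refine ⟨fun u v => ?_, h1.2.map Subtype.val⟩
  exact (h1.1 ⟨u, by simp⟩ ⟨v, by simp⟩).map (SimpleGraph.Embedding.induce _).toHom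

end Connectivity

/-! ### Degrees -/

section Degree

variable {k : ℕ} {e : ZMod 4}

open Classical in
-- Inner layers have degree 6; an end layer lacks two neighbors, and a diagonal gives one back to
-- each of its ends. The losses stand on the left to avoid subtraction in `ℕ`.
lemma degree_tower (v : QVertex k) : (tower k e).degree v +
    ((if v.1 = 0 then 2 else 0) + if v.1 = Fin.last (k + 1) then 2 else 0) =
    6 + ((if v.1 = 0 then (if odd4 v.2 then 0 else 1) else 0) +
      if v.1 = Fin.last (k + 1) then (if odd4 (v.2 - e) then 0 else 1) else 0) := by
  obtain ⟨i, j⟩ := v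
  have h1 : ∀ i', (∑ j', if (tower k e).Adj (i, j) (i', j') then 1 else 0) =
      (if i' = i then 2 + ((if i = 0 then (if odd4 j then 0 else 1) else 0) +
        if i = Fin.last (k + 1) then (if odd4 (j - e) then 0 else 1) else 0) else 0) +
      ((if i.val + 1 = i'.val then 2 else 0) + if i'.val + 1 = i.val then 2 else 0) := by
    intro i'
    have key : ∀ j d : ZMod 4, d = 1 ∨ d = -1 →
        (∑ j' : ZMod 4, if j' = j ∨ j' = j + d then 1 else 0) = 2 := by decide
    have key' : ∀ j d : ZMod 4, d = 1 ∨ d = -1 →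
        (∑ j' : ZMod 4, if j = j' ∨ j = j' + d then 1 else 0) = 2 := by decide
    have key2 : ∀ j : ZMod 4, ∀ b : Bool,
        (∑ j' : ZMod 4, if (j' = j + 1 ∨ j = j' + 1) ∨ (j' = j + 2 ∧ b = true) then 1 else 0) =
        2 + if b then 1 else 0 := by decide
    by_cases hi : i' = i
    · subst hi
      have h0 : (i' = 0) ↔ i'.val = 0 := Fin.ext_iff
      have hl : (i' = Fin.last (k + 1)) ↔ i'.val = k + 1 := Fin.ext_iff
      have := key2 j (decide ((i'.val = 0 ∧ odd4 j = false) ∨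
        (i'.val = k + 1 ∧ odd4 (j - e) = false)))
      simp only [h0, hl, tower, true_and, if_true, Nat.succ_ne_self, if_false, add_zero,
        false_and, false_or, decide_eq_true_eq] at this ⊢
      refine Eq.trans ?_ (this.trans ?_)
      · refine Finset.sum_congr rfl fun j' _ => ?_
        congr 1
      · by_cases hi0 : i'.val = 0
        · have : i'.val ≠ k + 1 := by omega
          simp only [hi0, true_and, if_true]
          cases odd4 j <;> simp
        · by_cases hik : i'.val = k + 1
          · simp only [hik, true_and, if_true]
            cases odd4 (j - e) <;> simp
          · simp [hi0, hik]
    · have hi' : ¬ i = i' := fun h => hi h.symm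
      by_cases hn : i.val + 1 = i'.val
      · have hp : ¬ i'.val + 1 = i.val := by omega
        simp only [tower_adj_next _ _ hn, key _ _ (slope_eq _), hi, hn, hp, if_true, if_false]
      · by_cases hp : i'.val + 1 = i.val
        · simp only [SimpleGraph.adj_comm _ (i, j), tower_adj_next _ _ hp, key' _ _ (slope_eq _),
            hi, hn, hp, if_true, if_false]
        · simp [tower, hi, hi', hn, hp]
  have h2 : (tower k e).degree (i, j) =
      ∑ i', ∑ j', if (tower k e).Adj (i, j) (i', j') then 1 else 0 := by
    rw [← SimpleGraph.card_neighborFinset_eq_degree, SimpleGraph.neighborFinset_eq_filter,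
      Finset.card_filter, Fintype.sum_prod_type]
  have h3 : (∑ i' : Fin (k + 2), if i.val + 1 = i'.val then 2 else 0) +
      (if i = Fin.last (k + 1) then 2 else 0) = 2 := by
    split_ifs with h
    · subst h
      rw [Finset.sum_eq_zero]
      intro x _
      rw [if_neg]
      simp; omega
    · have hi : i.val + 1 < k + 2 := by
        have : i.val ≠ k + 1 := fun h' => h (Fin.ext h')
        omega
      rw [Finset.sum_eq_single ⟨i + 1, hi⟩]
      · simp
      · intro b _ hb
        rw [if_neg]
        exact fun h' => hb (Fin.ext h'.symm)
      · simp
  have h4 : (∑ i' : Fin (k + 2), if i'.val + 1 = i.val then 2 else 0) +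
      (if i = 0 then 2 else 0) = 2 := by
    split_ifs with h
    · subst h
      rw [Finset.sum_eq_zero]
      intro x _
      rw [if_neg]
      simp
    · have hi : i.val ≠ 0 := fun h' => h (Fin.ext h')
      rw [Finset.sum_eq_single ⟨i - 1, by omega⟩]
      · rw [if_pos]; simp; omega
      · intro b _ hb
        rw [if_neg]
        exact fun h' => hb (Fin.ext (by simp; omega))
      · simp
  rw [h2]
  simp only [h1, Finset.sum_add_distrib, Finset.sum_ite_eq', Finset.mem_univ, if_true]
  omega

open Classical in
lemma card_dart_tower : Fintype.card (tower k e).Dart = 24 * k + 36 := by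
  have h := Finset.sum_congr (rfl : (Finset.univ : Finset (QVertex k)) = Finset.univ)
    fun v _ => degree_tower (e := e) v
  have key : ∀ e : ZMod 4, (∑ j : ZMod 4, if odd4 (j - e) then 0 else 1) = 2 := by decide
  have key0 : (∑ j : ZMod 4, if odd4 j then 0 else 1) = 2 := by decide
  simp only [Finset.sum_add_distrib, ← SimpleGraph.dart_card_eq_sum_degrees] at h
  have sw : ∀ (a : Fin (k + 2)) (f : ZMod 4 → ℕ),
      (∑ v : QVertex k, if v.1 = a then f v.2 else 0) = ∑ j, f j := by
    intro a f
    rw [Fintype.sum_prod_type_right]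
    simp
  have s1 := sw 0 fun _ => 2
  have s2 := sw (Fin.last (k + 1)) fun _ => 2
  rw [sw 0 fun j => if odd4 j then 0 else 1,
    sw (Fin.last (k + 1)) fun j => if odd4 (j - e) then 0 else 1, key, key0, s1, s2] at h
  simp at h
  omega

end Degree

/-! ### The homology degree -/

lemma RotationSystem.face_fst {V : Type*} {G : SimpleGraph V} (R : RotationSystem G)
    (d : G.Dart) : (R.face d).fst = d.snd := R.fst_rot d.symm

section HomologyDegree

variable {V : Type*} [Finite V] {G : SimpleGraph V}

lemma colors_ne (T : PlaneTriangulation G) (C : G.Coloring (Fin 4)) (d : G.Dart) :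
    C d.fst ≠ C (T.face d).fst ∧ C (T.face d).fst ≠ C (T.face (T.face d)).fst ∧
      C d.fst ≠ C (T.face (T.face d)).fst := by
  refine ⟨?_, ?_, ?_⟩
  · rw [T.face_fst]; exact C.valid d.adj
  · rw [T.face_fst (T.face d)]; exact C.valid (T.face d).adj
  · have := C.valid (T.face (T.face d)).adj
    rw [← T.face_fst, T.face_triangle] at this
    exact this.symm

lemma facesColored_rotate (T : PlaneTriangulation G) (C : G.Coloring (Fin 4)) (i j l : Fin 4) :
    facesColored T C i j l = facesColored T C j l i := by
  refine Nat.card_congr (T.face.subtypeEquiv fun d => ?_)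
  rw [T.face_triangle]
  tauto

lemma facesColored_eq_sum [Fintype G.Dart] (T : PlaneTriangulation G) (C : G.Coloring (Fin 4))
    (i j l : Fin 4) : facesColored T C i j l =
      ∑ d : G.Dart, if C d.fst = i ∧ C (T.face d).fst = j ∧ C (T.face (T.face d)).fst = l
        then 1 else 0 := by
  classical
  rw [facesColored, Nat.card_eq_fintype_card, Fintype.card_subtype, Finset.card_filter]

/-- The third color of a face at a dart colored `i, j` is `l` or `m`, so each side counts the darts
with one order of the two colors. Reversing darts matches the two counts. -/
lemma facesColored_add_swap (T : PlaneTriangulation G) (C : G.Coloring (Fin 4))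
    {i j l m : Fin 4} (h : i ≠ j ∧ i ≠ l ∧ i ≠ m ∧ j ≠ l ∧ j ≠ m ∧ l ≠ m) :
    facesColored T C i j l + facesColored T C i j m =
      facesColored T C j i l + facesColored T C j i m := by
  classical
  have : Fintype G.Dart := @Fintype.ofFinite _ (Finite.of_injective
    SimpleGraph.Dart.toProd SimpleGraph.Dart.toProd_injective)
  have key : ∀ i j l m : Fin 4, (i ≠ j ∧ i ≠ l ∧ i ≠ m ∧ j ≠ l ∧ j ≠ m ∧ l ≠ m) →
      facesColored T C i j l + facesColored T C i j m =
      ∑ d : G.Dart, if C d.fst = i ∧ C d.snd = j then 1 else 0 := by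
    intro i j l m h
    rw [facesColored_eq_sum, facesColored_eq_sum, ← Finset.sum_add_distrib]
    refine Finset.sum_congr rfl fun d _ => ?_
    obtain ⟨h1, h2, h3⟩ := colors_ne T C d
    rw [← T.face_fst]
    by_cases hi : C d.fst = i
    · by_cases hj : C (T.face d).fst = j
      · have : ∀ i j l m c : Fin 4, (i ≠ j ∧ i ≠ l ∧ i ≠ m ∧ j ≠ l ∧ j ≠ m ∧ l ≠ m) →
          j ≠ c → i ≠ c → (if c = l then 1 else 0) + (if c = m then 1 else 0) = 1 := by decide
        simp only [hi, hj, true_and]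
        exact this i j l m _ h (hj ▸ h2) (hi ▸ h3)
      · simp [hj]
    · simp [hi]
  rw [key i j l m h, key j i l m (by tauto)]
  refine Fintype.sum_equiv (SimpleGraph.Dart.symm_involutive.toPerm _) _ _ fun d => ?_
  simp [and_comm]

lemma sign_one_cases : ∀ σ : Equiv.Perm (Fin 4), Equiv.Perm.sign σ = 1 →
    (σ 1, σ 2, σ 3) ∈ [((1 : Fin 4), (2 : Fin 4), (3 : Fin 4)), (2, 3, 1), (3, 1, 2),
      (0, 3, 2), (3, 2, 0), (2, 0, 3), (0, 1, 3), (1, 3, 0), (3, 0, 1), (0, 2, 1), (2, 1, 0),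
      (1, 0, 2)] := by
  decide

/-- By `facesColored_add_swap`, the signed counts over two faces of the tetrahedron that share an
edge agree; rotations take care of the cyclic order. -/
lemma hasHomologyDegree (T : PlaneTriangulation G) (C : G.Coloring (Fin 4)) :
    HasHomologyDegree T C ((facesColored T C 1 2 3 : ℤ) - facesColored T C 2 1 3) := by
  intro σ hσ
  have r := facesColored_rotate T C
  have s0 := facesColored_add_swap T C (i := 1) (j := 2) (l := 3) (m := 0) (by decide)
  have s1 := facesColored_add_swap T C (i := 2) (j := 3) (l := 1) (m := 0) (by decide)
  have s2 := facesColored_add_swap T C (i := 3) (j := 1) (l := 2) (m := 0) (by decide)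
  have := sign_one_cases σ hσ
  simp only [List.mem_cons, Prod.mk.injEq, List.not_mem_nil, or_false] at this
  have r1 := r 1 2 3
  have r2 := r 2 3 1
  have r3 := r 2 1 3
  have r4 := r 1 3 2
  have t1 := r 1 2 0
  have t2 := r 2 0 1
  have t3 := r 2 1 0
  have t4 := r 1 0 2
  have u1 := r 1 3 0
  have u2 := r 3 0 1
  have u3 := r 3 1 0
  have u4 := r 1 0 3
  have v1 := r 2 3 0
  have v2 := r 3 0 2
  have v3 := r 3 2 0
  have v4 := r 2 0 3
  rcases this with ⟨h1, h2, h3⟩ | ⟨h1, h2, h3⟩ | ⟨h1, h2, h3⟩ | ⟨h1, h2, h3⟩ | ⟨h1, h2, h3⟩ |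
    ⟨h1, h2, h3⟩ | ⟨h1, h2, h3⟩ | ⟨h1, h2, h3⟩ | ⟨h1, h2, h3⟩ | ⟨h1, h2, h3⟩ | ⟨h1, h2, h3⟩ |
    ⟨h1, h2, h3⟩ <;> rw [h1, h2, h3] <;> omega

open Classical in
-- The faces without color 0 number `F` minus the degree sum of that class, and `F` is even because
-- `3F = 2E`. Their signed count has the same parity as their number.
lemma odd_facesColored_sub [Fintype V] (T : PlaneTriangulation G) (C : G.Coloring (Fin 4))
    (h : Odd (∑ v, if C v = 0 then G.degree v else 0)) :
    Odd ((facesColored T C 1 2 3 : ℤ) - facesColored T C 2 1 3) := by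
  have hX : (∑ d : G.Dart, if C d.fst = 0 then 1 else 0) =
      ∑ v, if C v = 0 then G.degree v else 0 := by
    rw [← Finset.sum_fiberwise Finset.univ fun d : G.Dart => d.fst]
    refine Finset.sum_congr rfl fun v _ => ?_
    rw [← G.dart_fst_fiber_card_eq_degree v, Finset.sum_congr rfl
      (g := fun _ => if C v = 0 then 1 else 0)]
    · split_ifs <;> simp
    · intro d hd
      rw [(Finset.mem_filter.1 hd).2]
  have hX1 : (∑ d : G.Dart, if C (T.face d).fst = 0 then 1 else 0) =
      ∑ d : G.Dart, if C d.fst = 0 then 1 else 0 :=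
    Equiv.sum_comp T.face fun d : G.Dart => if C d.fst = 0 then 1 else 0
  have hX2 : (∑ d : G.Dart, if C (T.face (T.face d)).fst = 0 then 1 else 0) =
      ∑ d : G.Dart, if C (T.face d).fst = 0 then 1 else 0 :=
    Equiv.sum_comp T.face fun d : G.Dart => if C (T.face d).fst = 0 then 1 else 0
  -- A face either has color 0 at exactly one vertex or shows 1, 2, 3 in one of the six orders.
  have key : ∀ a b c : Fin 4, a ≠ b → b ≠ c → a ≠ c → 1 =
      ((if a = 0 then 1 else 0) + (if b = 0 then 1 else 0) + if c = 0 then 1 else 0) +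
      ((if a = 1 ∧ b = 2 ∧ c = 3 then 1 else 0) + (if a = 2 ∧ b = 3 ∧ c = 1 then 1 else 0) +
        if a = 3 ∧ b = 1 ∧ c = 2 then 1 else 0) +
      ((if a = 2 ∧ b = 1 ∧ c = 3 then 1 else 0) + (if a = 1 ∧ b = 3 ∧ c = 2 then 1 else 0) +
        if a = 3 ∧ b = 2 ∧ c = 1 then 1 else 0) := by decide
  have hsum : Fintype.card G.Dart = 3 * (∑ v, if C v = 0 then G.degree v else 0) +
      3 * facesColored T C 1 2 3 + 3 * facesColored T C 2 1 3 := by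
    rw [← Finset.card_univ, Finset.card_eq_sum_ones, Finset.sum_congr rfl fun d _ =>
      key _ _ _ (colors_ne T C d).1 (colors_ne T C d).2.1 (colors_ne T C d).2.2]
    simp only [Finset.sum_add_distrib, ← facesColored_eq_sum, hX2, hX1, hX]
    rw [facesColored_rotate T C 3 1 2, ← facesColored_rotate T C 1 2 3,
      facesColored_rotate T C 3 2 1, ← facesColored_rotate T C 2 1 3]
    ring
  have heven := G.dart_card_eq_twice_card_edges
  rw [heven] at hsum
  obtain ⟨r, hr⟩ := h
  rw [hr] at hsum
  rw [Int.odd_iff]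
  omega

open Classical in
theorem hasOddHomologyDegree [Fintype V] {C' : G.Coloring (Fin 4)} (hs : Function.Surjective C')
    (h : ∀ a, Odd (∑ v, if C' v = a then G.degree v else 0)) :
    HasOddHomologyDegree G (classes C') := by
  intro T C hC
  obtain ⟨π, hπ⟩ := exists_perm_of_classes_eq hs hC
  refine ⟨_, odd_facesColored_sub T C ?_, hasHomologyDegree T C⟩
  -- Color 0 of `C` may be any color of `C'`, which is why all classes are assumed to have odd
  -- degree sum.
  simpa [hπ, ← Equiv.eq_symm_apply] using h (π.symm 0)

end HomologyDegree

open Classical in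
-- As `q (k + 1) ≠ odd4 e`, exactly one of the two end vertices of the class lies on a diagonal, so
-- exactly one term of the degree sum is odd.
lemma odd_sum_degree_spiral {k : ℕ} {e : ZMod 4} {q : ℕ → Bool} (h0 : q 0 = false)
    (hq : q (k + 1) ≠ odd4 e) (a : Fin 4) :
    Odd (∑ v, if spiral k e q v = a then (tower k e).degree v else 0) := by
  obtain ⟨m, rfl⟩ := hue.surjective a
  have h1 : (∑ v, if spiral k e q v = hue m then (tower k e).degree v else 0) =
      ∑ i : Fin (k + 2), (tower k e).degree (i, track q i + m) := by
    rw [Fintype.sum_prod_type]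
    refine Finset.sum_congr rfl fun i _ => ?_
    simp only [spiral_eq_hue_iff]
    simp
  have h2 := Finset.sum_congr (rfl : (Finset.univ : Finset (Fin (k + 2))) = Finset.univ)
    fun i _ => degree_tower (e := e) (i, track q i + m)
  have h3 : odd4 (track q (k + 1) + m - e) = !odd4 m := by
    have : ∀ t m e, odd4 (t + m - e) = xor (odd4 t) (xor (odd4 m) (odd4 e)) := by decide
    rw [this, odd4_track h0]
    revert hq; cases q (k + 1) <;> cases odd4 e <;> cases odd4 m <;> simp
  simp only [Finset.sum_add_distrib, Finset.sum_ite_eq', Finset.mem_univ, if_true,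
    Fin.val_last, Fin.val_zero, h3] at h2
  rw [h1]
  have h4 : odd4 (track q 0 + m) = odd4 m := by simp [track]
  simp only [h4] at h2
  simp at h2
  rw [Nat.odd_iff]
  cases h : odd4 m <;> simp [h] at h2 <;> omega

theorem hasOddHomologyDegree_coiled {k : ℕ} {e : ZMod 4} (t : Fin k → Bool) :
    HasOddHomologyDegree (tower k e) (classes (coiled e t true)) :=
  hasOddHomologyDegree (spiral_surjective _) (odd_sum_degree_spiral (parities_zero _ _) (by
    rw [parities_last]; simp))

/-! ### The triangulation -/

section FacePerm

variable {V : Type*} {G : SimpleGraph V}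

/-- The next dart of the face at the dart `(u, v)`, where `t u v` is the third vertex of that
face. -/
def faceStep (t : V → V → V) (h1 : ∀ u v, G.Adj u v → G.Adj v (t u v)) (d : G.Dart) : G.Dart :=
  ⟨(d.snd, t d.fst d.snd), h1 _ _ d.adj⟩

lemma faceStep_three {t : V → V → V} {h1 : ∀ u v, G.Adj u v → G.Adj v (t u v)}
    (h2 : ∀ u v, G.Adj u v → t v (t u v) = u) (d : G.Dart) :
    faceStep t h1 (faceStep t h1 (faceStep t h1 d)) = d := by
  apply SimpleGraph.Dart.ext
  have e1 := h2 _ _ d.adj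
  have e2 := h2 _ _ (h1 _ _ d.adj)
  simp only [faceStep]
  rw [e1] at e2 ⊢
  rw [e2]

/-- The face permutation given by the third vertices of the faces. -/
def facePerm (t : V → V → V) (h1 : ∀ u v, G.Adj u v → G.Adj v (t u v))
    (h2 : ∀ u v, G.Adj u v → t v (t u v) = u) : Equiv.Perm G.Dart where
  toFun := faceStep t h1
  invFun d := faceStep t h1 (faceStep t h1 d)
  left_inv := faceStep_three h2
  right_inv := faceStep_three h2

/-- The rotation system given by the third vertices of the faces. -/
def rotationSystemOfThird (t : V → V → V) (h1 : ∀ u v, G.Adj u v → G.Adj v (t u v))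
    (h2 : ∀ u v, G.Adj u v → t v (t u v) = u)
    (h3 : ∀ d e : G.Dart, d.fst = e.fst →
      Equiv.Perm.SameCycle ((Function.Involutive.toPerm _ SimpleGraph.Dart.symm_involutive).trans
        (facePerm t h1 h2)) d e) : RotationSystem G where
  rot := (Function.Involutive.toPerm _ SimpleGraph.Dart.symm_involutive).trans (facePerm t h1 h2)
  fst_rot _ := rfl
  sameCycle_rot := h3

lemma face_rotationSystemOfThird {t : V → V → V} {h1 : ∀ u v, G.Adj u v → G.Adj v (t u v)}
    {h2 : ∀ u v, G.Adj u v → t v (t u v) = u} {h3} (d : G.Dart) :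
    (rotationSystemOfThird t h1 h2 h3).face d = faceStep t h1 d := by
  change faceStep t h1 d.symm.symm = _
  rw [SimpleGraph.Dart.symm_symm]

/-- A cycle of the face permutation has length dividing 3, and length 1 is impossible because
`R.face d` starts at the other end of `d`. -/
lemma card_faces_mul_three [Finite V] (R : RotationSystem G)
    (h : ∀ d, R.face (R.face (R.face d)) = d) : Nat.card R.Faces * 3 = Nat.card G.Dart := by
  classical
  have : Fintype G.Dart := @Fintype.ofFinite _ (Finite.of_injective
    SimpleGraph.Dart.toProd SimpleGraph.Dart.toProd_injective)
  have : Fintype R.Faces := @Fintype.ofFinite _ (Quotient.finite _)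
  let π : G.Dart → R.Faces := Quotient.mk _
  have hπ : ∀ d d', π d' = π d ↔ d' = d ∨ d' = R.face d ∨ d' = R.face (R.face d) := by
    intro d d'
    rw [show π d' = π d ↔ R.face.SameCycle d' d from Quotient.eq (r := _)]
    constructor
    · intro hc
      obtain ⟨n, -, -, heq⟩ := hc.symm.exists_pow_eq''
      have hp : ∀ m, (R.face ^ (3 * m)) d = d := fun m => by
        induction m with
        | zero => simp
        | succ m ih =>
          rw [show 3 * (m + 1) = 3 * m + 1 + 1 + 1 by ring, pow_succ, pow_succ, pow_succ]
          simp only [Equiv.Perm.mul_apply, h, ih]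
      have hs : ∀ m r, (R.face ^ (3 * m + r)) d = (R.face ^ r) d := fun m r => by
        rw [add_comm, pow_add, Equiv.Perm.mul_apply, hp]
      rw [← Nat.div_add_mod n 3, hs] at heq
      have := Nat.mod_lt n (show 0 < 3 by norm_num)
      interval_cases n % 3
      · exact Or.inl heq.symm
      · exact Or.inr (Or.inl heq.symm)
      · exact Or.inr (Or.inr heq.symm)
    · rintro (rfl | rfl | rfl)
      · exact Equiv.Perm.SameCycle.refl _ _
      · simp [Equiv.Perm.SameCycle.refl]
      · simp [Equiv.Perm.SameCycle.refl]
  rw [Nat.card_eq_fintype_card, Nat.card_eq_fintype_card, ← Finset.card_univ (α := G.Dart),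
    Finset.card_eq_sum_card_fiberwise (t := (Finset.univ : Finset R.Faces)) (f := π)
      (fun _ _ => Finset.mem_coe.2 (Finset.mem_univ _)),
    Finset.sum_congr rfl (g := fun _ => 3)]
  · simp
  · intro K _
    induction K using Quotient.inductionOn with | h d => ?_
    have hn : ∀ d, R.face d ≠ d := fun d hd => by
      have := R.face_fst d
      rw [hd] at this
      exact d.adj.ne this
    have : Finset.univ.filter (fun d' => π d' = π d) = {d, R.face d, R.face (R.face d)} := by
      ext d'
      simp [hπ]
    change (Finset.univ.filter (fun d' => π d' = π d)).card = 3
    rw [this, Finset.card_eq_three]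
    refine ⟨_, _, _, (hn _).symm, fun h' => hn d ((congrArg R.face h').trans (h d)),
      (hn _).symm, rfl⟩

end FacePerm

/-! ### The explicit faces of the tower and its Euler characteristic -/

section TowerTriangulation

variable {k : ℕ} {e : ZMod 4}

/-- The vertex `(i, j)` is joined to `(i + 1, j + shift i)` and `(i + 1, j + shift i + 1)`. -/
def shift (i : ℕ) : ZMod 4 := if Even i then 0 else -1

lemma next_iff_shift (i : ℕ) (j j' : ZMod 4) :
    (j' = j ∨ j' = j + slope i) ↔ (j' = j + shift i ∨ j' = j + shift i + 1) := by
  unfold slope shift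
  split_ifs
  · simp
  · simp [or_comm]

/-- The third vertex of the face to the left of the dart from `x` to `y`. -/
def third (k : ℕ) (e : ZMod 4) (x y : QVertex k) : QVertex k :=
  if x.1 = y.1 then
    if y.2 = x.2 + 1 then
      if x.1 = 0 then (x.1, if odd4 x.2 then x.2 - 1 else x.2 + 2)
      else (x.1 - 1, x.2 - shift (x.1 - 1 : Fin (k + 2)))
    else if y.2 = x.2 - 1 then
      if x.1 = Fin.last (k + 1) then (x.1, if odd4 (x.2 - e) then x.2 + 1 else x.2 + 2)
      else (x.1 + 1, x.2 + shift x.1)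
    else if x.1 = 0 then (x.1, x.2 - 1) else (x.1, x.2 + 1)
  else if x.1.val + 1 = y.1.val then
    if y.2 = x.2 + shift x.1 then (y.1, y.2 + 1) else (x.1, x.2 + 1)
  else
    if x.2 = y.2 + shift y.1 then (y.1, y.2 - 1) else (x.1, x.2 - 1)

lemma third_inner (j : ZMod 4) : third k e (0, j) (0, j + 1) =
    (0, if odd4 j then j - 1 else j + 2) := by simp [third]

lemma add_two_add_two (j : ZMod 4) : j + 2 + 2 = j := by revert j; decide

lemma sub_one_eq (j : ZMod 4) : j - 1 = j + 2 + 1 := by revert j; decide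

lemma add_one_ne_add (j d : ZMod 4) : j + d + 1 ≠ j + d := by
  generalize j + d = x; revert x; decide

lemma odd4_add_one_sub (j e : ZMod 4) : odd4 (j + 1 - e) = !odd4 (j - e) := by
  revert j e; decide

lemma odd4_sub_one_sub (j e : ZMod 4) : odd4 (j - 1 - e) = !odd4 (j - e) := by
  revert j e; decide

lemma third_down {i i' : Fin (k + 2)} (h : i.val + 1 = i'.val) (j : ZMod 4) :
    third k e (i', j) (i', j + 1) = (i, j - shift i) := by
  have h0 : i' ≠ 0 := fun h' => by rw [h'] at h; simp at h
  have h1 : i' - 1 = i := by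
    apply Fin.ext
    rw [Fin.val_sub_one_of_ne_zero h0]
    omega
  simp [third, h0, h1]

lemma third_outer (j : ZMod 4) : third k e (Fin.last (k + 1), j) (Fin.last (k + 1), j - 1) =
    (Fin.last (k + 1), if odd4 (j - e) then j + 1 else j + 2) := by
  have h : j - 1 ≠ j + 1 := by revert j; decide
  simp [third, h]

lemma third_up {i i' : Fin (k + 2)} (h : i.val + 1 = i'.val) (j : ZMod 4) :
    third k e (i, j) (i, j - 1) = (i', j + shift i) := by
  have h' : j - 1 ≠ j + 1 := by revert j; decide
  have h0 : i ≠ Fin.last (k + 1) := fun h' => by rw [h'] at h; simp at h; omega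
  have h1 : i + 1 = i' := by
    apply Fin.ext
    rw [Fin.val_add_one_of_lt (lt_of_le_of_ne (Fin.le_last i) h0), h]
  simp [third, h0, h1, h']

lemma third_diag (i : Fin (k + 2)) (j : ZMod 4) : third k e (i, j) (i, j + 2) =
    if i = 0 then (i, j - 1) else (i, j + 1) := by
  have h1 : j + 2 ≠ j + 1 := by revert j; decide
  have h2 : j + 2 ≠ j - 1 := by revert j; decide
  simp only [third, h1, h2, if_true, if_false]

lemma third_up_left {i i' : Fin (k + 2)} (h : i.val + 1 = i'.val) (j : ZMod 4) :
    third k e (i, j) (i', j + shift i) = (i', j + shift i + 1) := by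
  have h' : i ≠ i' := fun h' => by rw [h'] at h; omega
  simp [third, h, h']

lemma third_up_right {i i' : Fin (k + 2)} (h : i.val + 1 = i'.val) (j : ZMod 4) :
    third k e (i, j) (i', j + shift i + 1) = (i, j + 1) := by
  have h' : i ≠ i' := fun h' => by rw [h'] at h; omega
  simp only [third, h, h', add_one_ne_add, if_true, if_false]

lemma third_down_left {i i' : Fin (k + 2)} (h : i.val + 1 = i'.val) (j : ZMod 4) :
    third k e (i', j + shift i) (i, j) = (i, j - 1) := by
  have h' : i' ≠ i := fun h' => by rw [h'] at h; omega
  have h2 : ¬ i'.val + 1 = i.val := by omega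
  simp [third, h', h2]

lemma third_down_right {i i' : Fin (k + 2)} (h : i.val + 1 = i'.val) (j : ZMod 4) :
    third k e (i', j + shift i + 1) (i, j) = (i', j + shift i) := by
  have h' : i' ≠ i := fun h' => by rw [h'] at h; omega
  have h2 : ¬ i'.val + 1 = i.val := by omega
  simp only [third, h', h2, add_one_ne_add, add_sub_cancel_right, if_false]

/-- The vertices of the diagonals. -/
def IsDiag (k : ℕ) (e : ZMod 4) (i : Fin (k + 2)) (j : ZMod 4) : Prop :=
  (i = 0 ∧ odd4 j = false) ∨ (i = Fin.last (k + 1) ∧ odd4 (j - e) = false)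

lemma adj_diag {i : Fin (k + 2)} {j : ZMod 4} (h : IsDiag k e i j) :
    (tower k e).Adj (i, j) (i, j + 2) :=
  Or.inr (Or.inr (Or.inr ⟨rfl, rfl, h.imp (And.imp_left Fin.ext_iff.1)
    (And.imp_left Fin.ext_iff.1)⟩))

lemma adj_left {i i' : Fin (k + 2)} (h : i.val + 1 = i'.val) (j : ZMod 4) :
    (tower k e).Adj (i, j) (i', j + shift i) :=
  (tower_adj_next i i' h _ _).2 ((next_iff_shift _ _ _).2 (Or.inl rfl))

lemma adj_right {i i' : Fin (k + 2)} (h : i.val + 1 = i'.val) (j : ZMod 4) :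
    (tower k e).Adj (i, j) (i', j + shift i + 1) :=
  (tower_adj_next i i' h _ _).2 ((next_iff_shift _ _ _).2 (Or.inr rfl))

lemma adj_pred (i : Fin (k + 2)) (j : ZMod 4) : (tower k e).Adj (i, j) (i, j - 1) := by
  have := (tower_adj_succ (e := e) i (j - 1)).symm
  rwa [sub_add_cancel] at this

/-- Case analysis on the neighbors of `x`. -/
lemma adj_cases {x : QVertex k} {p : QVertex k → Prop}
    (h1 : p (x.1, x.2 + 1)) (h2 : p (x.1, x.2 - 1)) (h3 : IsDiag k e x.1 x.2 → p (x.1, x.2 + 2))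
    (h4 : ∀ i', x.1.val + 1 = i'.val → p (i', x.2 + shift x.1))
    (h5 : ∀ i', x.1.val + 1 = i'.val → p (i', x.2 + shift x.1 + 1))
    (h6 : ∀ i', i'.val + 1 = x.1.val → p (i', x.2 - shift i'))
    (h7 : ∀ i', i'.val + 1 = x.1.val → p (i', x.2 - shift i' - 1))
    (y : QVertex k) (hxy : (tower k e).Adj x y) : p y := by
  obtain ⟨i, j⟩ := x
  obtain ⟨i', j'⟩ := y
  rcases hxy with ⟨h, h' | h'⟩ | ⟨h, h'⟩ | ⟨h, h'⟩ | ⟨h, h', h''⟩ <;> simp only at *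
  · subst h h'; exact h1
  · subst h h'; simpa using h2
  · rcases (next_iff_shift _ _ _).1 h' with rfl | rfl
    exacts [h4 _ h, h5 _ h]
  · rcases (next_iff_shift _ _ _).1 h' with h' | h'
    · have := h6 _ h
      rwa [h', add_sub_cancel_right] at this
    · have := h7 _ h
      rwa [h', show j' + shift i' + 1 - shift i' - 1 = j' by ring] at this
  · subst h h'
    exact h3 (h''.imp (And.imp_left Fin.ext_iff.2) (And.imp_left Fin.ext_iff.2))

lemma eq_zero_or_exists_pred (i : Fin (k + 2)) : i = 0 ∨ ∃ i' : Fin (k + 2), i'.val + 1 = i.val := by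
  by_cases h : i.val = 0
  · exact Or.inl (Fin.ext h)
  · exact Or.inr ⟨⟨i - 1, by omega⟩, by simp; omega⟩

lemma eq_last_or_exists_succ (i : Fin (k + 2)) :
    i = Fin.last (k + 1) ∨ ∃ i' : Fin (k + 2), i.val + 1 = i'.val := by
  by_cases h : i.val = k + 1
  · exact Or.inl (Fin.ext h)
  · exact Or.inr ⟨⟨i + 1, by omega⟩, rfl⟩

/-- These two conditions make the map `(x, y) ↦ (y, third x y)` on darts well defined and of order
3, so it is a face permutation with triangular faces. -/
lemma third_spec (x y : QVertex k) (h : (tower k e).Adj x y) :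
    (tower k e).Adj y (third k e x y) ∧ third k e y (third k e x y) = x := by
  refine adj_cases (p := fun y => (tower k e).Adj y (third k e x y) ∧
    third k e y (third k e x y) = x) ?_ ?_ ?_ ?_ ?_ ?_ ?_ y h <;> obtain ⟨i, j⟩ := x <;>
    simp only
  · rcases eq_zero_or_exists_pred i with rfl | ⟨i', hi'⟩
    · rw [third_inner]
      cases hj : odd4 j
      · simp only [Bool.false_eq_true, if_false]
        have e1 : j + 2 = j + 1 + 1 := by ring
        have e2 : odd4 (j + 1) = true := by rw [odd4_add_one, hj]; rfl
        rw [e1, third_inner, e2]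
        exact ⟨tower_adj_succ _ _, by simp⟩
      · simp only [if_true]
        have e1 : j - 1 = j + 1 + 2 := (sub_one_eq j).trans (by ring)
        have e2 : odd4 (j + 1) = false := by rw [odd4_add_one, hj]; rfl
        rw [e1, third_diag]
        exact ⟨adj_diag (Or.inl ⟨rfl, e2⟩), by simp⟩
    · rw [third_down hi']
      have e1 : j + 1 = j - shift i' + shift i' + 1 := by ring
      rw [e1, third_down_right hi']
      exact ⟨(adj_right hi' _).symm, by simp⟩
  · rcases eq_last_or_exists_succ i with rfl | ⟨i', hi'⟩
    · rw [third_outer]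
      cases hj : odd4 (j - e)
      · simp only [Bool.false_eq_true, if_false]
        have e1 : j + 2 = j - 1 - 1 := by rw [sub_one_eq]; ring
        have e2 : odd4 (j - 1 - e) = true := by rw [odd4_sub_one_sub, hj]; rfl
        rw [e1, third_outer, e2]
        exact ⟨adj_pred _ _, by simp⟩
      · simp only [if_true]
        have e1 : j + 1 = j - 1 + 2 := by ring
        have e2 : odd4 (j - 1 - e) = false := by rw [odd4_sub_one_sub, hj]; rfl
        rw [e1, third_diag, if_neg (by simp [Fin.ext_iff])]
        exact ⟨adj_diag (Or.inr ⟨rfl, e2⟩), by simp⟩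
    · rw [third_up hi']
      have e1 : j + shift i = j - 1 + shift i + 1 := by ring
      rw [e1, third_up_right hi']
      exact ⟨adj_right hi' _, by simp⟩
  · rintro (⟨rfl, hj⟩ | ⟨rfl, hj⟩)
    · rw [third_diag, if_pos rfl]
      have e1 := sub_one_eq j
      have e2 : odd4 (j + 2) = false := by rw [odd4_add_two, hj]
      rw [e1, third_inner, e2]
      refine ⟨tower_adj_succ _ _, ?_⟩
      simp only [Bool.false_eq_true, if_false, Prod.mk.injEq, true_and]
      exact add_two_add_two j
    · rw [third_diag, if_neg (by simp [Fin.ext_iff])]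
      have e1 : j + 1 = j + 2 - 1 := by ring
      have e2 : odd4 (j + 2 - e) = false := by rw [odd4_sub, odd4_add_two, ← odd4_sub, hj]
      rw [e1, third_outer, e2]
      refine ⟨adj_pred _ _, ?_⟩
      simp only [Bool.false_eq_true, if_false, Prod.mk.injEq, true_and]
      exact add_two_add_two j
  · intro i' hi'
    rw [third_up_left hi', third_down hi']
    exact ⟨tower_adj_succ _ _, by simp⟩
  · intro i' hi'
    have e1 : j + shift i + 1 = j + 1 + shift i := by ring
    rw [third_up_right hi', e1, third_down_left hi']
    exact ⟨(adj_left hi' _).symm, by simp⟩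
  · intro i' hi'
    have := third_down_left (e := e) hi' (j - shift i')
    rw [sub_add_cancel] at this
    rw [this, third_up hi']
    exact ⟨adj_pred _ _, by simp⟩
  · intro i' hi'
    have := third_down_right (e := e) hi' (j - shift i' - 1)
    rw [show j - shift i' - 1 + shift i' + 1 = j by ring] at this
    rw [this, third_up_left hi']
    exact ⟨adj_left hi' _, by simp; ring⟩

variable (k e) in
/-- The rotation at a vertex. -/
def towerRot : Equiv.Perm (tower k e).Dart :=
  (Function.Involutive.toPerm _ SimpleGraph.Dart.symm_involutive).trans
    (facePerm (third k e) (fun x y h => (third_spec x y h).1) fun x y h => (third_spec x y h).2)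

/-- The neighbors `y` of `x` for which the dart from `x` to `y` is in the cycle of `d`. -/
def InCycle (d : (tower k e).Dart) (x y : QVertex k) : Prop :=
  ∃ h : (tower k e).Adj x y, (towerRot k e).SameCycle d ⟨(x, y), h⟩

lemma InCycle.step {d : (tower k e).Dart} {x y z : QVertex k} (h : InCycle d x y)
    (hz : third k e y x = z) : InCycle d x z := by
  obtain ⟨h, hc⟩ := h
  subst hz
  exact ⟨(third_spec _ _ h.symm).1, hc.trans (Equiv.Perm.sameCycle_apply_right.2
    (Equiv.Perm.SameCycle.refl _ _))⟩

/-- Turning around `(i, j)` from `(i, j + 1)` meets the two outer neighbors, then `(i, j - 1)`, then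
the two inner ones. On the last layer an outer diagonal replaces the outer neighbors, and on layer 0
an inner diagonal follows `(i, j - 1)`. -/
lemma inCycle_of_adj (i : Fin (k + 2)) (j : ZMod 4) (y : QVertex k)
    (hy : (tower k e).Adj (i, j) y) :
    InCycle (e := e) ⟨((i, j), (i, j + 1)), tower_adj_succ i j⟩ (i, j) y := by
  set d : (tower k e).Dart := ⟨((i, j), (i, j + 1)), tower_adj_succ i j⟩
  have hs : InCycle d (i, j) (i, j + 1) := ⟨tower_adj_succ i j, Equiv.Perm.SameCycle.refl _ _⟩
  have hdiag : ∀ i : Fin (k + 2), third k e (i, j + 2) (i, j) =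
      if i = 0 then (i, j + 1) else (i, j - 1) := fun i => by
    have := third_diag (k := k) (e := e) i (j + 2)
    rw [add_two_add_two, ← sub_one_eq] at this
    rw [this, show j + 2 - 1 = j + 1 by ring]
  have up1 : ∀ i', i.val + 1 = i'.val → InCycle d (i, j) (i', j + shift i + 1) := fun i' hi' => by
    refine hs.step ?_
    have := third_up (e := e) hi' (j + 1)
    rw [add_sub_cancel_right] at this
    rw [this]; congr 1; ring
  have up0 : ∀ i', i.val + 1 = i'.val → InCycle d (i, j) (i', j + shift i) := fun i' hi' =>
    (up1 i' hi').step (third_down_right hi' j)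
  have outer : i = Fin.last (k + 1) → (odd4 (j - e) = false → InCycle d (i, j) (i, j + 2)) ∧
      InCycle d (i, j) (i, j - 1) := by
    intro hi
    have ho := third_outer (k := k) (e := e) (j + 1)
    rw [add_sub_cancel_right, ← hi, odd4_add_one_sub] at ho
    cases hj : odd4 (j - e)
    · rw [hj, Bool.not_false, if_pos rfl] at ho
      have h1 : InCycle d (i, j) (i, j + 2) := hs.step (ho.trans (by congr 1; ring))
      exact ⟨fun _ => h1, h1.step ((hdiag i).trans (if_neg (by rw [hi]; simp [Fin.ext_iff])))⟩
    · rw [hj, Bool.not_true, if_neg (by simp)] at ho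
      exact ⟨by simp, hs.step (ho.trans (by rw [sub_one_eq]; congr 1; ring))⟩
  have hp : InCycle d (i, j) (i, j - 1) := by
    rcases eq_last_or_exists_succ i with hi | ⟨i', hi'⟩
    · exact (outer hi).2
    · exact (up0 i' hi').step (third_down_left hi' j)
  have down1 : ∀ i', i'.val + 1 = i.val → InCycle d (i, j) (i', j - shift i' - 1) :=
    fun i' hi' => by
      refine hp.step ?_
      have := third_down (e := e) hi' (j - 1)
      rw [sub_add_cancel] at this
      rw [this]; congr 1; ring
  have down0 : ∀ i', i'.val + 1 = i.val → InCycle d (i, j) (i', j - shift i') :=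
    fun i' hi' => by
      refine (down1 i' hi').step ?_
      have := third_up_right (e := e) hi' (j - shift i' - 1)
      rw [show j - shift i' - 1 + shift i' + 1 = j by ring] at this
      rw [this]; congr 1; ring
  have inner : i = 0 → odd4 j = false → InCycle d (i, j) (i, j + 2) := by
    intro hi hj
    refine hp.step ?_
    have := third_inner (k := k) (e := e) (j - 1)
    rw [sub_add_cancel, ← hi, if_pos (by rw [sub_one_eq, odd4_add_one, odd4_add_two, hj]; rfl)]
      at this
    rw [this, sub_one_eq]; congr 1; ring
  refine adj_cases (p := InCycle d (i, j)) hs hp ?_ up0 up1 down0 down1 y hy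
  rintro (⟨h, h'⟩ | ⟨h, h'⟩)
  · exact inner h h'
  · exact (outer h).1 h'

variable (k e) in
/-- The tower as a triangulation of the plane. -/
def towerTriangulation : PlaneTriangulation (tower k e) :=
  let R : RotationSystem (tower k e) := rotationSystemOfThird (third k e)
    (fun x y h => (third_spec x y h).1) (fun x y h => (third_spec x y h).2) (by
      rintro ⟨⟨⟨i, j⟩, y⟩, h⟩ ⟨⟨x', y'⟩, h'⟩ hxy
      change (i, j) = x' at hxy
      subst hxy
      obtain ⟨_, h1⟩ := inCycle_of_adj i j y h
      obtain ⟨_, h2⟩ := inCycle_of_adj i j y' h'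
      exact h1.symm.trans h2)
  have hR : ∀ d, R.face (R.face (R.face d)) = d := fun d => by
    simp only [R, face_rotationSystemOfThird]
    exact faceStep_three (fun x y h => (third_spec x y h).2) d
  { R with
    connected := isVertexConnected_tower.connected (by norm_num)
    face_triangle := hR
    -- The counts are `V = 4k + 8`, `E = 12k + 18` and `F = 8k + 12`.
    euler := by
      classical
      have h1 := card_faces_mul_three R hR
      rw [Nat.card_eq_fintype_card (α := (tower k e).Dart), card_dart_tower] at h1
      have h2 := (tower k e).dart_card_eq_twice_card_edges
      rw [card_dart_tower, SimpleGraph.edgeFinset_card, ← Nat.card_eq_fintype_card] at h2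
      have h3 : Nat.card (QVertex k) = (k + 2) * 4 := by simp
      change (Nat.card (QVertex k) : ℤ) - Nat.card (tower k e).edgeSet + Nat.card R.Faces = 2
      rw [h3]
      omega }

end TowerTriangulation

end TutteComplex

theorem theorem5p1 (k : ℕ) (G : SimpleGraph (TutteComplex.QVertex k))
    (hG : G = TutteComplex.Q k ∨ G = TutteComplex.Q' k) :
    Nonempty (TutteComplex.PlaneTriangulation G) ∧
    TutteComplex.IsVertexConnected 4 G ∧
    Nat.card (TutteComplex.coloringComplex G).ConnectedComponent = 2 ^ k + 1 ∧
    ∃ K₀ : (TutteComplex.coloringComplex G).ConnectedComponent,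
      ((TutteComplex.coloringsIn K₀).ncard = 2 ^ (k + 1) ∧
        ∀ P ∈ TutteComplex.coloringsIn K₀, TutteComplex.IsOddColoring G P) ∧
      ∀ K : (TutteComplex.coloringComplex G).ConnectedComponent, K ≠ K₀ →
        ∃ P : Set (Set (TutteComplex.QVertex k)),
          TutteComplex.coloringsIn K = {P} ∧
          TutteComplex.IsEvenColoring G P ∧
          TutteComplex.HasOddHomologyDegree G P := by
  obtain ⟨e, rfl⟩ : ∃ e, G = TutteComplex.tower k e := by
    rcases hG with h | h
    -- The second end `e + 2` of the outer diagonal evaluates to 2 for `e = 0` and to 3 for `e = 1`.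
    · exact ⟨0, TutteComplex.eq_tower 0 h⟩
    · exact ⟨1, TutteComplex.eq_tower 1 h⟩
  refine ⟨⟨TutteComplex.towerTriangulation k e⟩, TutteComplex.isVertexConnected_tower,
    TutteComplex.card_components, TutteComplex.mainComponent k e,
    ⟨TutteComplex.ncard_coloringsIn_mainComponent, fun P hP => ?_⟩, fun K hK => ?_⟩
  · obtain ⟨t, rfl⟩ | ⟨t, rfl⟩ := TutteComplex.mem_coloringsIn_mainComponent.1 hP
    exacts [TutteComplex.isOddColoring_coiled t, TutteComplex.isOddColoring_banded t]
  · obtain rfl | ⟨t, rfl⟩ := TutteComplex.eq_mainComponent_or K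
    · exact absurd rfl hK
    · exact ⟨_, TutteComplex.coloringsIn_isolatedComponent t,
        TutteComplex.isEvenColoring_coiled t, TutteComplex.hasOddHomologyDegree_coiled t⟩
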